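/- **Lemma.** Let $P,R\in\mathbb R^2$, and let $\lambda,\gamma\subset\mathbb R^2$ be simple rectifiable curves from $P$ to $R$. That is, $\lambda=c([0,1])$ for a continuous map $c:[0,1]\to\mathbb R^2$ of finite length with $c(0)=P$ and $c(1)=R$, such that $c(s)=c(t)$ with $s<t$ occurs at most for $s=0$, $t=1$ (so only for closed curves, when $P=R$); similarly for $\gamma$. Let $\tau'$ and $\tau''$ be $\mathcal H^1$-measurable unit vector fields on $\lambda$ and $\gamma$ orienting these curves, i.e. at $\mathcal H^1$-almost every point of the curve the field is the unit tangent vector in the direction of travel from $P$ to $R$. Consider the $\mathbb R^2$-valued measures $$\Lambda=\tau'\cdot\mathcal H^1\llcorner\lambda,\qquad \Gamma=\tau''\cdot\mathcal H^1\llcorner\gamma .$$ Then there is a function $u\in SBV(\mathbb R^2;\mathbb Z)$ such that $$Du^{\perp}=\Gamma-\Lambda .$$ Here $u\in SBV(\mathbb R^2;\mathbb Z)$ means that $u\in L^1(\mathbb R^2)$ is integer valued almost everywhere, that its distributional gradient is a finite $\mathbb R^2$-valued measure $Du=(D_1u,D_2u)$, and that the Cantor part of $Du$ vanishes, i.e.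 the part of $Du$ singular with respect to Lebesgue measure is concentrated on the set $S_u$ of points at which $u$ has no ($L^1$) approximate limit. Moreover, $Du^\perp=(-D_2u,D_1u)$ is the orthogonal gradient. -/

import Mathlib

open MeasureTheory Set Filter Topology
open scoped ContDiff

noncomputable section

/-- The Euclidean plane. -/
abbrev Plane : Type := EuclideanSpace ℝ (Fin 2)

/-! ### Simple rectifiable curves and the vector measures they carry -/

/-- `c : [0,1] → ℝ²` parametrizes a simple rectifiable curve from `P` to `R`: it is continuous,
has finite length, and takes no value twice, except that a closed curve has `c 0 = c 1`. -/
structure IsSimpleRectifiableCurve (c : ℝ → Plane) (P R : Plane) : Prop where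
  continuousOn : ContinuousOn c (Icc 0 1)
  source : c 0 = P
  target : c 1 = R
  finite_length : eVariationOn c (Icc 0 1) < ⊤
  simple : ∀ s ∈ Icc (0 : ℝ) 1, ∀ t ∈ Icc (0 : ℝ) 1, s < t → c s = c t → s = 0 ∧ t = 1

/-- The set of points of the curve parametrized by `c`. -/
def curveSupport (c : ℝ → Plane) : Set Plane := c '' Icc (0 : ℝ) 1

/-- `v` is the unit tangent vector at the point `c t`, in the direction of travel: it is the limit
of the normalized chords through `c t`, each oriented by increasing parameter. The notion does
not change under increasing reparametrization. -/
def IsOrientedUnitTangent (c : ℝ → Plane) (t : ℝ) (v : Plane) : Prop :=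
  Tendsto (fun s : ℝ => ((s - t) / |s - t|) • ((‖c s - c t‖)⁻¹ • (c s - c t))) (𝓝[≠] t) (𝓝 v)

/-- The curve parametrized by `c` is oriented by the `ℋ¹`-measurable unit vector field `τ`. -/
structure IsOrientedBy (c : ℝ → Plane) (τ : Plane → Plane) : Prop where
  measurable : AEStronglyMeasurable τ ((μH[1]).restrict (curveSupport c))
  norm_eq_one : ∀ᵐ x ∂(μH[1] : Measure Plane).restrict (curveSupport c), ‖τ x‖ = 1
  tangent : ∀ᵐ x ∂(μH[1] : Measure Plane).restrict (curveSupport c),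
    ∃ t ∈ Ioo (0 : ℝ) 1, c t = x ∧ IsOrientedUnitTangent c t (τ x)

/-- The vector measure `τ · ℋ¹ ⌞ λ`, where `λ` is the curve parametrized by `c`. -/
def curveMeasure (c : ℝ → Plane) (τ : Plane → Plane) : VectorMeasure Plane Plane :=
  ((μH[1] : Measure Plane).restrict (curveSupport c)).withDensityᵥ τ

/-! ### Functions of bounded variation and special functions of bounded variation -/

/-- The distributional gradient of `u` is represented by the finite vector measure `Du`:
`∫ u ∇φ dx = - ∫ φ dDu` for every test function `φ`. -/
def HasGradientMeasure (u : Plane → ℝ) (Du : VectorMeasure Plane Plane) : Prop :=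
  ∀ φ : Plane → ℝ, ContDiff ℝ ∞ φ → HasCompactSupport φ →
    ∫ x, u x • gradient φ x = - ∫ᵛ x, φ x ∂•Du

/-- The approximate discontinuity set `S_u`: the points where `u` has no approximate limit in the
`L¹` sense. -/
def approxDiscontinuitySet (u : Plane → ℝ) : Set Plane :=
  {x | ¬ ∃ z : ℝ, Tendsto (fun r : ℝ => ⨍ y in Metric.ball x r, |u y - z|) (𝓝[>] 0) (𝓝 0)}

/-- `u ∈ SBV(ℝ²)` with gradient measure `Du`: `u` is integrable, its distributional gradient is
the finite vector measure `Du`, and the Cantor part of `Du` (the restriction to the complement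
of `S_u` of the part of `Du` singular to Lebesgue measure) vanishes. -/
structure IsSBV (u : Plane → ℝ) (Du : VectorMeasure Plane Plane) : Prop where
  integrable : Integrable u
  hasGradientMeasure : HasGradientMeasure u Du
  cantorPart_eq_zero : (Du.variation.singularPart volume) (approxDiscontinuitySet u)ᶜ = 0

/-- `u ∈ SBV(ℝ²; ℤ)` with gradient measure `Du`. -/
structure IsSBVInt (u : Plane → ℝ) (Du : VectorMeasure Plane Plane) : Prop
    extends IsSBV u Du where
  integer_valued : ∀ᵐ x, ∃ n : ℤ, u x = n

/-- Counterclockwise rotation by a right angle, `(v₀, v₁) ↦ (-v₁, v₀)`. -/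
def rotPerp : Plane →ₗ[ℝ] Plane where
  toFun v := !₂[-v 1, v 0]
  map_add' v w := by ext i; fin_cases i <;> simp [add_comm]
  map_smul' a v := by ext i; fin_cases i <;> simp

/-- The rotated vector measure `μ^⊥`, `(μ₀, μ₁) ↦ (-μ₁, μ₀)`. For `μ = Du` this is the orthogonal
gradient `Du^⊥`. -/
def perpMeasure (μ : VectorMeasure Plane Plane) : VectorMeasure Plane Plane :=
  μ.mapRange rotPerp.toAddMonoidHom rotPerp.continuous_of_finiteDimensional

end

/-! The function `u` plays the role of a winding number of the closed curve formed by the two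
curves, but is built as a sum of triangles, so that integrality and integrability are immediate.

Filling (`LipschitzOnWith.exists_integer_filling`). Inscribe in a 1-Lipschitz curve on `[0, L]` the
polygons with `2 ^ n` dyadic edges. Two consecutive polygons differ by the boundaries of `2 ^ n`
triangles, each of area `O(L ^ 2 / 4 ^ n)`. The signed indicators of all these triangles therefore
sum in `L¹` to an integer-valued function, and Green's formula telescopes: its rotated gradient is,
up to sign, the curve minus the chord of its endpoints. Both curves have the same chord from `P` to
`R`, so it cancels in the difference of the two fillings.

Curves (`exists_lipschitz_parametrization`). A simple curve has length at most the `ℋ¹`-measure of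
its image, so its arc-length parametrization carries Lebesgue measure to `ℋ¹` and its derivative is
the given tangent field almost everywhere.

No Cantor part (`isSBV_of_linear_growth`). `Du` has a density `θ` with respect to `ℋ¹` on the union
of the curves, a measure `μ` with `μ(B_r) ≥ r` at small scales since curves are connected. At a
Lebesgue point `x` of `θ` where `u` has an approximate limit, testing with a bump of scale `r` gives
`|θ x| μ(B_r) ≤ o(r) + o(1) μ(B_2r)`. Along scales with `μ(B_2r) ≤ 4 μ(B_r)` this forces `θ x = 0`.
-/

/-! ### Signed triangles and Green's formula. -/

/-- The standard triangle in the plane. -/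
def stdTriangle : Set Plane := {x | 0 ≤ x 0 ∧ 0 ≤ x 1 ∧ x 0 + x 1 ≤ 1}

lemma isCompact_prodTriangle : IsCompact {z : ℝ × ℝ | 0 ≤ z.1 ∧ 0 ≤ z.2 ∧ z.1 + z.2 ≤ 1} := by
  refine (isCompact_Icc (a := ((0, 0) : ℝ × ℝ)) (b := (1, 1))).of_isClosed_subset ?_ ?_
  · simp only [ofPred_and]
    refine (isClosed_le ?_ ?_).inter ((isClosed_le ?_ ?_).inter (isClosed_le ?_ ?_))
    all_goals fun_prop
  · rintro ⟨x, y⟩ ⟨h1, h2, h3⟩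
    simp only at h1 h2 h3
    exact ⟨⟨h1, h2⟩, ⟨by simp only; linarith, by simp only; linarith⟩⟩

lemma setIntegral_prodTriangle {g : ℝ × ℝ → ℝ} (hg : Continuous g) :
    ∫ z in {z : ℝ × ℝ | 0 ≤ z.1 ∧ 0 ≤ z.2 ∧ z.1 + z.2 ≤ 1}, g z =
      ∫ s in (0 : ℝ)..1, ∫ t in (0 : ℝ)..(1 - s), g (s, t) := by
  have hm := isCompact_prodTriangle.measurableSet
  have hint : Integrable
      ({z : ℝ × ℝ | 0 ≤ z.1 ∧ 0 ≤ z.2 ∧ z.1 + z.2 ≤ 1}.indicator g) := by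
    rw [integrable_indicator_iff hm]
    exact hg.continuousOn.integrableOn_compact isCompact_prodTriangle
  rw [← integral_indicator hm, Measure.volume_eq_prod, integral_prod _ hint,
    intervalIntegral.integral_of_le zero_le_one, ← integral_Icc_eq_integral_Ioc,
    ← integral_indicator measurableSet_Icc]
  congr 1
  ext s
  by_cases hs : s ∈ Icc (0 : ℝ) 1
  · rw [indicator_of_mem hs, intervalIntegral.integral_of_le (by linarith [hs.2]),
      ← integral_Icc_eq_integral_Ioc, ← integral_indicator measurableSet_Icc]
    congr 1
    ext t
    by_cases ht : t ∈ Icc 0 (1 - s)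
    · rw [indicator_of_mem ht, indicator_of_mem]
      exact ⟨hs.1, ht.1, by simp only; linarith [ht.2]⟩
    · rw [indicator_of_notMem ht, indicator_of_notMem]
      exact fun h ↦ ht ⟨h.2.1, by linarith [h.2.2]⟩
  · rw [indicator_of_notMem hs]
    convert integral_zero ℝ ℝ with t
    rw [indicator_of_notMem]
    rintro ⟨h1, h2, h3⟩
    simp only at h1 h2 h3
    exact hs ⟨h1, by linarith⟩

lemma isCompact_stdTriangle : IsCompact stdTriangle := by
  refine Metric.isCompact_of_isClosed_isBounded ?_ ?_
  · simp only [stdTriangle, ofPred_and]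
    refine (isClosed_le ?_ ?_).inter ((isClosed_le ?_ ?_).inter (isClosed_le ?_ ?_))
    all_goals fun_prop
  · refine (Metric.isBounded_iff_subset_closedBall 0).2 ⟨2, fun x hx ↦ ?_⟩
    obtain ⟨h1, h2, h3⟩ := hx
    rw [mem_closedBall_zero_iff, EuclideanSpace.norm_eq, Fin.sum_univ_two]
    apply Real.sqrt_le_iff.2 ⟨by norm_num, ?_⟩
    simp only [Real.norm_eq_abs, sq_abs]
    nlinarith

lemma measurePreserving_planeEquiv :
    MeasurePreserving (fun x : Plane ↦ ((x 0, x 1) : ℝ × ℝ)) :=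
  (volume_preserving_finTwoArrow ℝ).comp
    (EuclideanSpace.volume_preserving_symm_measurableEquiv_toLp (Fin 2))

lemma setIntegral_stdTriangle {g : Plane → ℝ} (hg : Continuous g) :
    ∫ x in stdTriangle, g x = ∫ s in (0 : ℝ)..1, ∫ t in (0 : ℝ)..(1 - s), g !₂[s, t] := by
  rw [← setIntegral_prodTriangle (g := fun z ↦ g !₂[z.1, z.2])
    (hg.comp ((PiLp.continuous_toLp 2 _).comp (by fun_prop)))]
  rw [← measurePreserving_planeEquiv.setIntegral_preimage_emb
    ((MeasurableEquiv.finTwoArrow.measurableEmbedding).comp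
      (MeasurableEquiv.toLp 2 _).symm.measurableEmbedding)]
  apply setIntegral_congr_fun isCompact_stdTriangle.measurableSet
  intro x _
  simp only
  congr 1
  ext i
  fin_cases i <;> simp

/-- Both orders of integration are needed, so that either partial derivative can be integrated
first. -/
lemma setIntegral_stdTriangle_swap {g : Plane → ℝ} (hg : Continuous g) :
    ∫ x in stdTriangle, g x = ∫ t in (0 : ℝ)..1, ∫ s in (0 : ℝ)..(1 - t), g !₂[s, t] := by
  have hg' : Continuous (fun z : ℝ × ℝ ↦ g !₂[z.1, z.2]) :=
    hg.comp ((PiLp.continuous_toLp 2 _).comp (by fun_prop))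
  rw [setIntegral_stdTriangle hg, ← setIntegral_prodTriangle (g := fun z ↦ g !₂[z.1, z.2]) hg',
    ← setIntegral_prodTriangle (g := fun z ↦ g !₂[z.2, z.1]) (hg'.comp continuous_swap)]
  rw [Measure.volume_eq_prod, ← (Measure.measurePreserving_swap (μ := (volume : Measure ℝ))
    (ν := (volume : Measure ℝ))).setIntegral_preimage_emb
      MeasurableEquiv.prodComm.measurableEmbedding (fun z : ℝ × ℝ ↦ g !₂[z.1, z.2])]
  have : Prod.swap ⁻¹' {z : ℝ × ℝ | 0 ≤ z.1 ∧ 0 ≤ z.2 ∧ z.1 + z.2 ≤ 1} =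
      {z : ℝ × ℝ | 0 ≤ z.1 ∧ 0 ≤ z.2 ∧ z.1 + z.2 ≤ 1} := by
    ext z
    simp only [mem_preimage, mem_ofPred_eq, Prod.fst_swap, Prod.snd_swap, add_comm]
    tauto
  rw [this]
  rfl

/-- The determinant of two plane vectors. -/
def planeDet (a b : Plane) : ℝ := a 0 * b 1 - a 1 * b 0

lemma abs_planeDet_le (a b : Plane) : |planeDet a b| ≤ ‖a‖ * ‖b‖ := by
  rw [EuclideanSpace.norm_eq, EuclideanSpace.norm_eq, ← Real.sqrt_mul (by positivity)]
  apply Real.abs_le_sqrt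
  simp only [planeDet, Fin.sum_univ_two, Real.norm_eq_abs, sq_abs]
  -- Lagrange's identity: `‖a‖² ‖b‖² = det² + ⟨a, b⟩²`.
  nlinarith [sq_nonneg (a 0 * b 0 + a 1 * b 1)]

/-- Turns the Jacobian times a rotated gradient into directional derivatives along the two edges of
a triangle. -/
lemma planeDet_smul_rotPerp (a b v : Plane) :
    planeDet a b • rotPerp v = inner ℝ v a • b - inner ℝ v b • a := by
  ext i
  fin_cases i <;> simp [planeDet, rotPerp, PiLp.inner_apply, Fin.sum_univ_two] <;> ring

/-- The linear map sending the standard basis of the plane to `a, b`. -/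
noncomputable def frameMap (a b : Plane) : Plane →L[ℝ] Plane :=
  (EuclideanSpace.proj 0 : Plane →L[ℝ] ℝ).smulRight a +
    (EuclideanSpace.proj 1 : Plane →L[ℝ] ℝ).smulRight b

lemma frameMap_apply (a b x : Plane) : frameMap a b x = x 0 • a + x 1 • b := rfl

lemma det_frameMap (a b : Plane) : (frameMap a b).det = planeDet a b := by
  have : (frameMap a b).det = LinearMap.det (frameMap a b : Plane →ₗ[ℝ] Plane) := rfl
  rw [this, ← LinearMap.det_toMatrix (EuclideanSpace.basisFun (Fin 2) ℝ).toBasis,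
    Matrix.det_fin_two]
  simp [LinearMap.toMatrix_apply, frameMap_apply, planeDet]
  ring

lemma frameMap_injective {a b : Plane} (h : planeDet a b ≠ 0) :
    Function.Injective (frameMap a b) := by
  have h' : IsUnit (LinearMap.det (frameMap a b : Plane →ₗ[ℝ] Plane)) := by
    have := det_frameMap a b
    exact isUnit_iff_ne_zero.2 (by rw [← this] at h; exact h)
  have := ((LinearMap.isUnit_iff_isUnit_det _).2 h')
  exact ((Module.End.isUnit_iff _).1 this).1

/-- The signed indicator function of the triangle with vertices `p, q, r`. -/
noncomputable def signedTriangle (p q r : Plane) : Plane → ℝ :=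
  ((fun x ↦ p + frameMap (q - p) (r - p) x) '' stdTriangle).indicator
    fun _ ↦ Real.sign (planeDet (q - p) (r - p))

lemma isCompact_affineTriangle (p a b : Plane) :
    IsCompact ((fun x ↦ p + frameMap a b x) '' stdTriangle) :=
  isCompact_stdTriangle.image (by fun_prop)

lemma integrable_signedTriangle (p q r : Plane) : Integrable (signedTriangle p q r) := by
  have h := isCompact_affineTriangle p (q - p) (r - p)
  refine (integrable_indicator_iff h.measurableSet).2 (integrableOn_const h.measure_lt_top.ne)

lemma exists_int_signedTriangle (p q r x : Plane) : ∃ n : ℤ, signedTriangle p q r x = n := by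
  unfold signedTriangle
  by_cases hx : x ∈ (fun x ↦ p + frameMap (q - p) (r - p) x) '' stdTriangle
  · rw [indicator_of_mem hx]
    rcases Real.sign_apply_eq (planeDet (q - p) (r - p)) with h | h | h
    · exact ⟨-1, by simp [h]⟩
    · exact ⟨0, by simp [h]⟩
    · exact ⟨1, by simp [h]⟩
  · exact ⟨0, by rw [indicator_of_notMem hx]; simp⟩

/-- Affine change of variables: the orientation sign cancels the absolute value of the Jacobian. For
a degenerate triangle both sides vanish. -/
lemma integral_signedTriangle_smul {E : Type*} [NormedAddCommGroup E] [NormedSpace ℝ E]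
    (p q r : Plane) (F : Plane → E) :
    ∫ x, signedTriangle p q r x • F x =
      planeDet (q - p) (r - p) •
        ∫ x in stdTriangle, F (p + frameMap (q - p) (r - p) x) := by
  set d := planeDet (q - p) (r - p) with hd
  by_cases h0 : d = 0
  · have : ∀ x, signedTriangle p q r x = 0 := by
      intro x
      simp only [signedTriangle, ← hd, h0, Real.sign_zero, indicator_zero]
    simp [this, h0]
  have hm := (isCompact_affineTriangle p (q - p) (r - p)).measurableSet
  have h1 : (fun x ↦ signedTriangle p q r x • F x) =
      ((fun x ↦ p + frameMap (q - p) (r - p) x) '' stdTriangle).indicator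
        fun x ↦ Real.sign d • F x := by
    ext x
    by_cases hx : x ∈ (fun x ↦ p + frameMap (q - p) (r - p) x) '' stdTriangle
    · rw [signedTriangle, indicator_of_mem hx, indicator_of_mem hx]
    · rw [signedTriangle, indicator_of_notMem hx, indicator_of_notMem hx, zero_smul]
  rw [h1, integral_indicator hm, integral_smul,
    integral_image_eq_integral_abs_det_fderiv_smul volume isCompact_stdTriangle.measurableSet
      (f' := fun _ ↦ frameMap (q - p) (r - p))]
  · simp only [det_frameMap, ← hd]
    rw [integral_smul, smul_smul]
    congr 1
    rcases lt_or_gt_of_ne h0 with h | h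
    · rw [Real.sign_of_neg h, abs_of_neg h]; ring
    · rw [Real.sign_of_pos h, abs_of_pos h]; ring
  · intro x _
    exact ((frameMap _ _).hasFDerivAt.const_add p).hasFDerivWithinAt
  · intro x _ y _ hxy
    exact frameMap_injective h0 (add_left_cancel hxy)

/-- The absolute value is the function times its own constant sign, so the previous formula applies.
The bound is quadratic in the edge lengths, which makes the dyadic layers summable. -/
lemma integral_abs_signedTriangle_le (p q r : Plane) :
    ∫ x, |signedTriangle p q r x| ≤ volume.real stdTriangle * (‖q - p‖ * ‖r - p‖) := by
  have h : ∀ x, |signedTriangle p q r x| =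
      signedTriangle p q r x • Real.sign (planeDet (q - p) (r - p)) := by
    intro x
    by_cases hx : x ∈ (fun x ↦ p + frameMap (q - p) (r - p) x) '' stdTriangle
    · rw [signedTriangle, indicator_of_mem hx]
      rcases Real.sign_apply_eq (planeDet (q - p) (r - p)) with h | h | h <;> simp [h]
    · rw [signedTriangle, indicator_of_notMem hx]; simp
  simp_rw [h]
  rw [integral_signedTriangle_smul, setIntegral_const, smul_eq_mul, smul_eq_mul]
  have h2 : planeDet (q - p) (r - p) * (volume.real stdTriangle *
      Real.sign (planeDet (q - p) (r - p))) =
      volume.real stdTriangle * |planeDet (q - p) (r - p)| := by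
    rcases lt_trichotomy (planeDet (q - p) (r - p)) 0 with h | h | h
    · rw [Real.sign_of_neg h, abs_of_neg h]; ring
    · simp [h]
    · rw [Real.sign_of_pos h, abs_of_pos h]; ring
  rw [h2]
  gcongr
  exact abs_planeDet_le _ _

/-- The integral of `φ` along the segment from `p` to `q`. -/
noncomputable def segmentIntegral (φ : Plane → ℝ) (p q : Plane) : Plane :=
  (∫ t in (0 : ℝ)..1, φ (p + t • (q - p))) • (q - p)

lemma segmentIntegral_symm (φ : Plane → ℝ) (p q : Plane) :
    segmentIntegral φ q p = - segmentIntegral φ p q := by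
  unfold segmentIntegral
  have h := intervalIntegral.integral_comp_sub_left (a := 0) (b := 1)
    (fun t : ℝ ↦ φ (p + t • (q - p))) 1
  rw [sub_zero, sub_self] at h
  rw [← h, ← neg_sub q p, smul_neg]
  congr 3
  ext t
  congr 1
  module

/-- **Green's formula for a triangle.** -/
lemma rotPerp_integral_signedTriangle_smul_gradient (p q r : Plane) {φ : Plane → ℝ}
    (hφ : ContDiff ℝ 1 φ) :
    rotPerp (∫ x, signedTriangle p q r x • gradient φ x) =
      segmentIntegral φ p q + segmentIntegral φ q r + segmentIntegral φ r p := by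
  set a := q - p with ha
  set b := r - p with hb
  have hgrad : ∀ x v, inner ℝ (gradient φ x) v = fderiv ℝ φ x v := by
    intro x v
    rw [gradient, InnerProductSpace.toDual_symm_apply]
  have hcf : Continuous (fderiv ℝ φ) := hφ.continuous_fderiv one_ne_zero
  have hcg : Continuous (gradient φ) :=
    (InnerProductSpace.toDual ℝ Plane).symm.continuous.comp hcf
  have hd : ∀ x, HasFDerivAt φ (fderiv ℝ φ x) x :=
    fun x ↦ (hφ.differentiable one_ne_zero x).hasFDerivAt
  have hcA : Continuous fun x : Plane ↦ p + frameMap a b x := by fun_prop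
  have hcpd : ∀ v, Continuous fun x ↦ fderiv ℝ φ (p + frameMap a b x) v :=
    fun v ↦ (hcf.comp hcA).clm_apply continuous_const
  have hint : IntegrableOn (fun x ↦ gradient φ (p + frameMap a b x)) stdTriangle :=
    (hcg.comp hcA).continuousOn.integrableOn_compact isCompact_stdTriangle
  have hA : ∀ s t : ℝ, p + frameMap a b !₂[s, t] = p + s • a + t • b := by
    intro s t
    simp [frameMap_apply, add_assoc]
  -- the two partial derivatives integrate to boundary terms
  have hs : ∫ x in stdTriangle, fderiv ℝ φ (p + frameMap a b x) a =
      (∫ t in (0 : ℝ)..1, φ (p + (1 - t) • a + t • b)) - ∫ t in (0 : ℝ)..1, φ (p + t • b) := by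
    rw [setIntegral_stdTriangle_swap (hcpd a),
      ← intervalIntegral.integral_sub]
    rotate_left
    · exact (hφ.continuous.comp (by fun_prop)).intervalIntegrable _ _
    · exact (hφ.continuous.comp (by fun_prop)).intervalIntegrable _ _
    apply intervalIntegral.integral_congr
    intro t _
    simp only [hA]
    rw [intervalIntegral.integral_eq_sub_of_hasDerivAt
      (f := fun s : ℝ ↦ φ (p + s • a + t • b))]
    · simp
    · intro s _
      have h1 : HasDerivAt (fun s : ℝ ↦ p + s • a + t • b) a s := by
        simpa using (((hasDerivAt_id s).smul_const a).const_add p).add_const (t • b)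
      exact (hd _).comp_hasDerivAt s h1
    · exact ((hcf.comp (by fun_prop)).clm_apply continuous_const).intervalIntegrable _ _
  have ht : ∫ x in stdTriangle, fderiv ℝ φ (p + frameMap a b x) b =
      (∫ t in (0 : ℝ)..1, φ (p + (1 - t) • a + t • b)) - ∫ t in (0 : ℝ)..1, φ (p + t • a) := by
    -- Reversing the parameter makes the hypotenuse term the same integral as in `hs`.
    have h0 := intervalIntegral.integral_comp_sub_left (a := 0) (b := 1)
      (fun t : ℝ ↦ φ (p + (1 - t) • a + t • b)) 1
    rw [sub_zero, sub_self] at h0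
    rw [setIntegral_stdTriangle (hcpd b), ← h0,
      ← intervalIntegral.integral_sub]
    rotate_left
    · exact (hφ.continuous.comp (by fun_prop)).intervalIntegrable _ _
    · exact (hφ.continuous.comp (by fun_prop)).intervalIntegrable _ _
    apply intervalIntegral.integral_congr
    intro s _
    simp only [hA]
    rw [intervalIntegral.integral_eq_sub_of_hasDerivAt
      (f := fun t : ℝ ↦ φ (p + s • a + t • b))]
    · simp
    · intro t _
      have h1 : HasDerivAt (fun t : ℝ ↦ p + s • a + t • b) b t := by
        simpa using ((hasDerivAt_id t).smul_const b).const_add (p + s • a)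
      exact (hd _).comp_hasDerivAt t h1
    · exact ((hcf.comp (by fun_prop)).clm_apply continuous_const).intervalIntegrable _ _
  -- The legs give the edges at `p`; the two hypotenuse terms carry `b` and `-a`, and combine into
  -- the edge `r - q = b - a`.
  rw [integral_signedTriangle_smul, map_smul, planeDet_smul_rotPerp, ← ha, ← hb]
  have hin : ∀ v : Plane, inner ℝ (∫ x in stdTriangle, gradient φ (p + frameMap a b x)) v =
      ∫ x in stdTriangle, fderiv ℝ φ (p + frameMap a b x) v := by
    intro v
    rw [real_inner_comm, ← integral_inner hint]
    simp_rw [real_inner_comm _ v, hgrad]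
  rw [hin, hin, hs, ht, segmentIntegral_symm φ p r]
  unfold segmentIntegral
  rw [← ha, ← hb]
  have hqr : (∫ t in (0 : ℝ)..1, φ (q + t • (r - q))) =
      ∫ t in (0 : ℝ)..1, φ (p + (1 - t) • a + t • b) := by
    congr 1
    ext t
    congr 1
    rw [ha, hb]
    module
  have hba : r - q = b - a := by rw [ha, hb]; abel
  rw [hqr, hba]
  module

/-! ### Filling a Lipschitz curve by dyadic triangles. -/

section LipschitzCurve

variable {w : ℝ → Plane} {L : ℝ}

lemma LipschitzOnWith.norm_deriv_le_one_of_mem_Ioo (hw : LipschitzOnWith 1 w (Icc 0 L)) {s : ℝ}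
    (hs : s ∈ Ioo 0 L) : ‖deriv w s‖ ≤ 1 := by
  simpa using norm_deriv_le_of_lipschitzOn (Icc_mem_nhds hs.1 hs.2) hw

lemma LipschitzOnWith.ae_differentiableAt_Ioo (hw : LipschitzOnWith 1 w (Icc 0 L)) :
    ∀ᵐ s : ℝ, s ∈ Ioo 0 L → DifferentiableAt ℝ w s := by
  filter_upwards [hw.ae_differentiableWithinAt_of_mem_real] with s hs hs'
  exact (hs (Ioo_subset_Icc_self hs')).differentiableAt (Icc_mem_nhds hs'.1 hs'.2)

lemma ae_mem_Ioo_of_mem_Icc (a b : ℝ) : ∀ᵐ s : ℝ, s ∈ Icc a b → s ∈ Ioo a b := by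
  filter_upwards [Measure.ae_ne volume a, Measure.ae_ne volume b] with s h1 h2 hs
  exact ⟨lt_of_le_of_ne hs.1 h1.symm, lt_of_le_of_ne hs.2 h2⟩

lemma LipschitzOnWith.intervalIntegrable_smul_deriv (hw : LipschitzOnWith 1 w (Icc 0 L))
    {f : ℝ → ℝ} (hf : ContinuousOn f (Icc 0 L)) {a b : ℝ} (ha : 0 ≤ a) (hab : a ≤ b) (hb : b ≤ L) :
    IntervalIntegrable (fun s ↦ f s • deriv w s) volume a b := by
  have hI : IntervalIntegrable f volume a b :=
    (hf.mono (by rw [uIcc_of_le hab]; exact Icc_subset_Icc ha hb)).intervalIntegrable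
  rw [intervalIntegrable_iff] at hI ⊢
  refine Integrable.mono hI (hI.aestronglyMeasurable.smul
    (stronglyMeasurable_deriv w).aestronglyMeasurable) ?_
  refine (ae_restrict_iff' measurableSet_uIoc).2 ?_
  filter_upwards [ae_mem_Ioo_of_mem_Icc 0 L] with s hs hs'
  rw [uIoc_of_le hab] at hs'
  rw [norm_smul]
  exact mul_le_of_le_one_right (norm_nonneg _)
    (hw.norm_deriv_le_one_of_mem_Ioo (hs ⟨ha.trans hs'.1.le, hs'.2.trans hb⟩))

/-- Each coordinate is Lipschitz, hence absolutely continuous. -/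
lemma LipschitzOnWith.integral_deriv_eq_sub_of_le (hw : LipschitzOnWith 1 w (Icc 0 L)) {a b : ℝ}
    (ha : 0 ≤ a) (hab : a ≤ b) (hb : b ≤ L) : ∫ s in a..b, deriv w s = w b - w a := by
  have hI : IntervalIntegrable (deriv w) volume a b := by
    simpa using hw.intervalIntegrable_smul_deriv (f := fun _ ↦ 1) continuousOn_const ha hab hb
  ext i
  have h1 : ∫ s in a..b, deriv w s i = (∫ s in a..b, deriv w s) i :=
    (EuclideanSpace.proj i : Plane →L[ℝ] ℝ).intervalIntegral_comp_comm hI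
  have hlip : LipschitzOnWith 1 (fun s ↦ w s i) (uIcc a b) := by
    have h := (EuclideanSpace.proj i : Plane →L[ℝ] ℝ).lipschitz
    rw [uIcc_of_le hab]
    refine LipschitzOnWith.of_dist_le_mul fun x hx y hy ↦ ?_
    refine le_trans ?_ ((hw.mono (Icc_subset_Icc ha hb)).dist_le_mul x hx y hy)
    rw [dist_eq_norm, dist_eq_norm]
    exact PiLp.norm_apply_le (w x - w y) i
  have h2 := hlip.absolutelyContinuousOnInterval.integral_deriv_eq_sub
  rw [← h1, PiLp.sub_apply, ← h2]
  apply intervalIntegral.integral_congr_ae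
  filter_upwards [ae_mem_Ioo_of_mem_Icc 0 L, hw.ae_differentiableAt_Ioo] with s hs hd hs'
  rw [uIoc_of_le hab] at hs'
  have hd' := (hd (hs ⟨ha.trans hs'.1.le, hs'.2.trans hb⟩)).hasDerivAt
  exact (((EuclideanSpace.proj i : Plane →L[ℝ] ℝ).hasFDerivAt.comp_hasDerivAt s hd').deriv).symm

/-- Freezing `φ` at `w a` changes each integral by at most `K (b - a) ^ 2`, and the frozen integrals
coincide. The quadratic error survives summation over `2 ^ n` pieces as `O(2⁻ⁿ)`. -/
lemma LipschitzOnWith.norm_integral_smul_deriv_sub_segmentIntegral_le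
    (hw : LipschitzOnWith 1 w (Icc 0 L)) {φ : Plane → ℝ} {K : NNReal} (hφ : LipschitzWith K φ)
    {a b : ℝ} (ha : 0 ≤ a) (hab : a ≤ b) (hb : b ≤ L) :
    ‖(∫ s in a..b, φ (w s) • deriv w s) - segmentIntegral φ (w a) (w b)‖ ≤
      2 * K * (b - a) ^ 2 := by
  have hsub : Icc a b ⊆ Icc 0 L := Icc_subset_Icc ha hb
  have hwab : ‖w b - w a‖ ≤ b - a := by
    have := hw.dist_le_mul b (hsub ⟨hab, le_rfl⟩) a (hsub ⟨le_rfl, hab⟩)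
    rwa [dist_eq_norm, Real.dist_eq, abs_of_nonneg (sub_nonneg.2 hab), NNReal.coe_one,
      one_mul] at this
  have hI := hw.intervalIntegrable_smul_deriv (f := fun s ↦ φ (w s))
    (hφ.continuous.comp_continuousOn hw.continuousOn) ha hab hb
  have hI' := hw.intervalIntegrable_smul_deriv (f := fun _ ↦ φ (w a))
    continuousOn_const ha hab hb
  have hJ : IntervalIntegrable (fun t : ℝ ↦ φ (w a + t • (w b - w a))) volume 0 1 :=
    (hφ.continuous.comp (by fun_prop)).intervalIntegrable _ _
  have hsplit : (∫ s in a..b, φ (w s) • deriv w s) - segmentIntegral φ (w a) (w b) =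
      (∫ s in a..b, (φ (w s) - φ (w a)) • deriv w s) -
        (∫ t in (0 : ℝ)..1, (φ (w a + t • (w b - w a)) - φ (w a))) • (w b - w a) := by
    simp_rw [sub_smul]
    rw [intervalIntegral.integral_sub hI hI', intervalIntegral.integral_smul,
      hw.integral_deriv_eq_sub_of_le ha hab hb,
      intervalIntegral.integral_sub hJ intervalIntegrable_const, segmentIntegral]
    simp only [intervalIntegral.integral_const, sub_zero, one_smul, sub_smul]
    abel
  rw [hsplit]
  have h1 : ‖∫ s in a..b, (φ (w s) - φ (w a)) • deriv w s‖ ≤ K * (b - a) * |b - a| := by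
    apply intervalIntegral.norm_integral_le_of_norm_le_const_ae
    filter_upwards [ae_mem_Ioo_of_mem_Icc 0 L] with s hs hs'
    rw [uIoc_of_le hab] at hs'
    have hsL : s ∈ Icc 0 L := ⟨ha.trans hs'.1.le, hs'.2.trans hb⟩
    rw [norm_smul]
    have h2 : ‖φ (w s) - φ (w a)‖ ≤ K * (b - a) := by
      rw [← dist_eq_norm]
      refine (hφ.dist_le_mul _ _).trans ?_
      gcongr
      have := hw.dist_le_mul s hsL a (hsub ⟨le_rfl, hab⟩)
      rw [Real.dist_eq, abs_of_nonneg (sub_nonneg.2 hs'.1.le), NNReal.coe_one, one_mul] at this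
      linarith [hs'.2]
    calc _ ≤ K * (b - a) * 1 := by
          gcongr
          exact hw.norm_deriv_le_one_of_mem_Ioo (hs hsL)
      _ = _ := mul_one _
  have h2 : ‖∫ t in (0 : ℝ)..1, (φ (w a + t • (w b - w a)) - φ (w a))‖ ≤
      K * (b - a) * |(1 : ℝ) - 0| := by
    apply intervalIntegral.norm_integral_le_of_norm_le_const
    intro t ht
    rw [uIoc_of_le zero_le_one] at ht
    rw [← dist_eq_norm]
    refine (hφ.dist_le_mul _ _).trans ?_
    gcongr
    rw [dist_eq_norm, add_sub_cancel_left, norm_smul, Real.norm_of_nonneg ht.1.le]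
    calc t * ‖w b - w a‖ ≤ 1 * (b - a) := by gcongr; exact ht.2
      _ = _ := one_mul _
  calc _ ≤ ‖∫ s in a..b, (φ (w s) - φ (w a)) • deriv w s‖ +
        ‖(∫ t in (0 : ℝ)..1, (φ (w a + t • (w b - w a)) - φ (w a))) • (w b - w a)‖ :=
        _root_.norm_sub_le _ _
    _ ≤ K * (b - a) * |b - a| + K * (b - a) * |(1 : ℝ) - 0| * (b - a) := by
        rw [norm_smul]
        gcongr
    _ = _ := by
        rw [abs_of_nonneg (sub_nonneg.2 hab)]
        norm_num
        ring

/-- The vertices of the dyadic polygons inscribed in a curve. -/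
noncomputable def dyadicVertex (w : ℝ → Plane) (L : ℝ) (n j : ℕ) : Plane := w (j * (L / 2 ^ n))

lemma dyadicVertex_succ_two_mul (w : ℝ → Plane) (L : ℝ) (n j : ℕ) :
    dyadicVertex w L (n + 1) (2 * j) = dyadicVertex w L n j := by
  unfold dyadicVertex
  congr 1
  push_cast
  field_simp
  ring

/-- The sum of the signed triangles between two consecutive dyadic polygons. -/
noncomputable def dyadicLayer (w : ℝ → Plane) (L : ℝ) (n : ℕ) (x : Plane) : ℝ :=
  ∑ j ∈ Finset.range (2 ^ n), signedTriangle (dyadicVertex w L n j)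
    (dyadicVertex w L (n + 1) (2 * j + 1)) (dyadicVertex w L n (j + 1)) x

/-- The integral of `φ` along a dyadic polygon. -/
noncomputable def polygonIntegral (φ : Plane → ℝ) (w : ℝ → Plane) (L : ℝ) (n : ℕ) : Plane :=
  ∑ j ∈ Finset.range (2 ^ n), segmentIntegral φ (dyadicVertex w L n j) (dyadicVertex w L n (j + 1))

lemma Finset.sum_range_two_mul {M : Type*} [AddCommMonoid M] (f : ℕ → M) (m : ℕ) :
    ∑ j ∈ Finset.range (2 * m), f j = ∑ j ∈ Finset.range m, (f (2 * j) + f (2 * j + 1)) := by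
  induction m with
  | zero => simp
  | succ m ih => rw [Finset.sum_range_succ, ← ih, Nat.mul_succ, Finset.sum_range_succ,
      Finset.sum_range_succ, add_assoc]

lemma integrable_dyadicLayer (w : ℝ → Plane) (L : ℝ) (n : ℕ) : Integrable (dyadicLayer w L n) :=
  integrable_finsetSum _ fun _ _ ↦ integrable_signedTriangle _ _ _

lemma exists_int_dyadicLayer (w : ℝ → Plane) (L : ℝ) (n : ℕ) (x : Plane) :
    ∃ k : ℤ, dyadicLayer w L n x = k := by
  choose k hk using fun j ↦ exists_int_signedTriangle (dyadicVertex w L n j)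
    (dyadicVertex w L (n + 1) (2 * j + 1)) (dyadicVertex w L n (j + 1)) x
  exact ⟨∑ j ∈ Finset.range (2 ^ n), k j, by simp [dyadicLayer, hk]⟩

lemma dyadic_mem_Icc (hL : 0 ≤ L) {n j : ℕ} (hj : j ≤ 2 ^ n) : j * (L / 2 ^ n) ∈ Icc 0 L := by
  refine ⟨by positivity, ?_⟩
  have : (j : ℝ) ≤ 2 ^ n := by exact_mod_cast hj
  calc j * (L / 2 ^ n) ≤ 2 ^ n * (L / 2 ^ n) := by gcongr
    _ = L := by field_simp

lemma LipschitzOnWith.integral_abs_dyadicLayer_le (hw : LipschitzOnWith 1 w (Icc 0 L))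
    (hL : 0 ≤ L) (n : ℕ) :
    ∫ x, ‖dyadicLayer w L n x‖ ≤ volume.real stdTriangle * L ^ 2 * (1 / 2) ^ n := by
  have hdist : ∀ m k m' k', k ≤ 2 ^ m → k' ≤ 2 ^ m' →
      ‖dyadicVertex w L m k - dyadicVertex w L m' k'‖ ≤
        |k * (L / 2 ^ m) - k' * (L / 2 ^ m')| := by
    intro m k m' k' h h'
    have := hw.dist_le_mul _ (dyadic_mem_Icc hL h) _ (dyadic_mem_Icc hL h')
    rwa [dist_eq_norm, Real.dist_eq, NNReal.coe_one, one_mul] at this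
  calc ∫ x, ‖dyadicLayer w L n x‖
      ≤ ∫ x, ∑ j ∈ Finset.range (2 ^ n), |signedTriangle (dyadicVertex w L n j)
        (dyadicVertex w L (n + 1) (2 * j + 1)) (dyadicVertex w L n (j + 1)) x| := by
        refine integral_mono (integrable_dyadicLayer w L n).norm
          (integrable_finsetSum _ fun _ _ ↦ (integrable_signedTriangle _ _ _).norm) fun x ↦ ?_
        exact Finset.abs_sum_le_sum_abs _ _
    _ = ∑ j ∈ Finset.range (2 ^ n), ∫ x, |signedTriangle (dyadicVertex w L n j)
        (dyadicVertex w L (n + 1) (2 * j + 1)) (dyadicVertex w L n (j + 1)) x| :=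
        integral_finsetSum _ fun _ _ ↦ (integrable_signedTriangle _ _ _).norm
    _ ≤ ∑ j ∈ Finset.range (2 ^ n), volume.real stdTriangle * ((L / 2 ^ n) * (L / 2 ^ n)) := by
        refine Finset.sum_le_sum fun j hj ↦ (integral_abs_signedTriangle_le _ _ _).trans ?_
        have hj' : j < 2 ^ n := Finset.mem_range.1 hj
        have hp : 0 ≤ L / 2 ^ n := by positivity
        gcongr
        · refine (hdist _ _ _ _ (by rw [pow_succ]; lia) hj'.le).trans ?_
          rw [show ((2 * j + 1 : ℕ) : ℝ) * (L / 2 ^ (n + 1)) - j * (L / 2 ^ n) =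
            L / 2 ^ n / 2 by push_cast; field_simp; ring, abs_of_nonneg (by positivity)]
          linarith
        · refine (hdist _ _ _ _ hj' hj'.le).trans ?_
          rw [show ((j + 1 : ℕ) : ℝ) * (L / 2 ^ n) - j * (L / 2 ^ n) =
            L / 2 ^ n by push_cast; ring, abs_of_nonneg (by positivity)]
    _ = _ := by
        rw [Finset.sum_const, Finset.card_range, nsmul_eq_mul]
        push_cast
        rw [one_div, inv_pow]
        field_simp

/-- The boundary of each triangle is two edges of the finer polygon followed by one edge of the
coarser polygon, reversed. -/
lemma rotPerp_integral_dyadicLayer (w : ℝ → Plane) (L : ℝ) (n : ℕ) {φ : Plane → ℝ}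
    (hφ : ContDiff ℝ 1 φ) (hc : HasCompactSupport φ) :
    rotPerp (∫ x, dyadicLayer w L n x • gradient φ x) =
      polygonIntegral φ w L (n + 1) - polygonIntegral φ w L n := by
  have hcg : Continuous (gradient φ) :=
    (InnerProductSpace.toDual ℝ Plane).symm.continuous.comp (hφ.continuous_fderiv one_ne_zero)
  obtain ⟨C, hC⟩ := (hc.fderiv (𝕜 := ℝ)).exists_bound_of_continuous
    (hφ.continuous_fderiv one_ne_zero)
  have hC' : ∀ x, ‖gradient φ x‖ ≤ C := fun x ↦ by
    rw [gradient, LinearIsometryEquiv.norm_map]; exact hC x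
  have hI : ∀ p q r : Plane, Integrable fun x ↦ signedTriangle p q r x • gradient φ x :=
    fun p q r ↦ (integrable_signedTriangle p q r).smul_of_top_left
      (memLp_top_of_bound hcg.aestronglyMeasurable C (Eventually.of_forall hC'))
  simp_rw [dyadicLayer, Finset.sum_smul]
  rw [integral_finsetSum _ fun _ _ ↦ hI _ _ _, map_sum, polygonIntegral, polygonIntegral,
    pow_succ', Finset.sum_range_two_mul, ← Finset.sum_sub_distrib]
  refine Finset.sum_congr rfl fun j _ ↦ ?_
  rw [rotPerp_integral_signedTriangle_smul_gradient _ _ _ hφ, dyadicVertex_succ_two_mul,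
    show 2 * j + 1 + 1 = 2 * (j + 1) by ring, dyadicVertex_succ_two_mul,
    segmentIntegral_symm φ (dyadicVertex w L n j) (dyadicVertex w L n (j + 1))]
  abel

lemma LipschitzOnWith.tendsto_polygonIntegral (hw : LipschitzOnWith 1 w (Icc 0 L)) (hL : 0 ≤ L)
    {φ : Plane → ℝ} {K : NNReal} (hφ : LipschitzWith K φ) :
    Tendsto (polygonIntegral φ w L) atTop (𝓝 (∫ s in (0 : ℝ)..L, φ (w s) • deriv w s)) := by
  rw [tendsto_iff_norm_sub_tendsto_zero]
  refine squeeze_zero (g := fun n : ℕ ↦ 2 * K * L ^ 2 * (1 / 2) ^ n) (fun _ ↦ norm_nonneg _)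
    (fun n ↦ ?_) ?_
  · have hmono : ∀ j : ℕ, j * (L / 2 ^ n) ≤ (j + 1 : ℕ) * (L / 2 ^ n) := by
      intro j
      have : 0 ≤ L / 2 ^ n := by positivity
      gcongr
      lia
    have hsum : ∫ s in (0 : ℝ)..L, φ (w s) • deriv w s = ∑ j ∈ Finset.range (2 ^ n),
        ∫ s in (j * (L / 2 ^ n))..((j + 1 : ℕ) * (L / 2 ^ n)), φ (w s) • deriv w s := by
      rw [intervalIntegral.sum_integral_adjacent_intervals (a := fun j : ℕ ↦ j * (L / 2 ^ n))]
      · congr 1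
        · simp
        · push_cast; field_simp
      · intro j hj
        exact hw.intervalIntegrable_smul_deriv (f := fun s ↦ φ (w s))
          (hφ.continuous.comp_continuousOn hw.continuousOn) (dyadic_mem_Icc hL hj.le).1
          (hmono j) (dyadic_mem_Icc hL (Nat.succ_le_of_lt hj)).2
    rw [hsum, polygonIntegral, norm_sub_rev, ← Finset.sum_sub_distrib]
    refine (norm_sum_le _ _).trans ?_
    calc _ ≤ ∑ j ∈ Finset.range (2 ^ n), 2 * K * (L / 2 ^ n) ^ 2 := by
          refine Finset.sum_le_sum fun j hj ↦ ?_
          have hj' : j < 2 ^ n := Finset.mem_range.1 hj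
          refine (hw.norm_integral_smul_deriv_sub_segmentIntegral_le hφ
            (dyadic_mem_Icc hL hj'.le).1 (hmono j)
            (dyadic_mem_Icc hL (Nat.succ_le_of_lt hj')).2).trans_eq ?_
          congr 2
          push_cast
          ring
      _ = _ := by
        rw [Finset.sum_const, Finset.card_range, nsmul_eq_mul]
        push_cast
        rw [one_div, inv_pow]
        field_simp
  · simpa using (tendsto_pow_atTop_nhds_zero_of_lt_one (r := (1 / 2 : ℝ)) (by norm_num)
      (by norm_num)).const_mul (2 * K * L ^ 2)

/-- The integers are closed in `ℝ`. -/
lemma exists_int_tsum_of_summable {f : ℕ → ℝ} (hf : Summable f) (h : ∀ n, ∃ k : ℤ, f n = k) :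
    ∃ k : ℤ, ∑' n, f n = k := by
  choose k hk using h
  have hcl : IsClosed (range ((↑) : ℤ → ℝ)) := Int.isClosedEmbedding_coe_real.isClosed_range
  have := hcl.mem_of_tendsto hf.hasSum.tendsto_sum_nat
    (Eventually.of_forall fun n ↦ ⟨∑ i ∈ Finset.range n, k i, by simp [hk]⟩)
  obtain ⟨m, hm⟩ := this
  exact ⟨m, hm.symm⟩

lemma ae_summable_norm_of_summable_integral_norm {α E : Type*} [MeasurableSpace α]
    {μ : Measure α} [NormedAddCommGroup E] {F : ℕ → α → E} (hF : ∀ n, Integrable (F n) μ)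
    (hs : Summable fun n ↦ ∫ x, ‖F n x‖ ∂μ) :
    (∀ᵐ x ∂μ, Summable fun n ↦ ‖F n x‖) ∧ ∑' n, ∫⁻ x, ‖F n x‖ₑ ∂μ ≠ ⊤ := by
  have h : ∑' n, ∫⁻ x, ‖F n x‖ₑ ∂μ ≠ ⊤ := by
    have : ∀ n, ∫⁻ x, ‖F n x‖ₑ ∂μ = ENNReal.ofReal (∫ x, ‖F n x‖ ∂μ) := fun n ↦
      (ofReal_integral_norm_eq_lintegral_enorm (hF n)).symm
    simp_rw [this]
    exact hs.tsum_ofReal_ne_top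
  refine ⟨?_, h⟩
  rw [← lintegral_tsum fun n ↦ (hF n).aestronglyMeasurable.enorm] at h
  have hm : AEMeasurable (fun x ↦ ∑' n, ‖F n x‖ₑ) μ :=
    AEMeasurable.tsum fun n ↦ (hF n).aestronglyMeasurable.enorm
  filter_upwards [ae_lt_top' hm h] with x hx
  have := ENNReal.summable_toReal hx.ne
  simpa using this

/-- **Filling of a curve.** A Lipschitz curve is, up to the segment joining its endpoints, the
rotated gradient of an integrable integer-valued function. -/
lemma LipschitzOnWith.exists_integer_filling (hw : LipschitzOnWith 1 w (Icc 0 L)) (hL : 0 ≤ L) :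
    ∃ v : Plane → ℝ, Integrable v ∧ (∀ᵐ x, ∃ n : ℤ, v x = n) ∧
      ∀ φ : Plane → ℝ, ContDiff ℝ 1 φ → HasCompactSupport φ →
        rotPerp (∫ x, v x • gradient φ x) =
          (∫ s in (0 : ℝ)..L, φ (w s) • deriv w s) - segmentIntegral φ (w 0) (w L) := by
  have hint := integrable_dyadicLayer w L
  have hsum : Summable fun n ↦ ∫ x, ‖dyadicLayer w L n x‖ :=
    Summable.of_nonneg_of_le (fun n ↦ integral_nonneg fun x ↦ norm_nonneg _)
      (hw.integral_abs_dyadicLayer_le hL)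
      ((summable_geometric_of_lt_one (by norm_num) (by norm_num)).mul_left _)
  obtain ⟨hae, htop⟩ := ae_summable_norm_of_summable_integral_norm hint hsum
  refine ⟨fun x ↦ ∑' n, dyadicLayer w L n x, ⟨?_, ?_⟩, ?_, ?_⟩
  · refine aestronglyMeasurable_of_tendsto_ae atTop (f := fun n x ↦
      ∑ k ∈ Finset.range n, dyadicLayer w L k x) (fun n ↦ ?_) ?_
    · exact (integrable_finsetSum _ fun k _ ↦ hint k).aestronglyMeasurable
    · filter_upwards [hae] with x hx
      exact hx.of_norm.hasSum.tendsto_sum_nat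
  · refine lt_of_le_of_lt ?_ htop.lt_top
    rw [← lintegral_tsum fun n ↦ (hint n).aestronglyMeasurable.enorm]
    exact lintegral_mono fun x ↦ enorm_tsum_le_tsum_enorm
  · filter_upwards [hae] with x hx
    exact exists_int_tsum_of_summable hx.of_norm fun n ↦ exists_int_dyadicLayer w L n x
  · intro φ hφ hc
    obtain ⟨K, hK⟩ := hφ.lipschitzWith_of_hasCompactSupport hc one_ne_zero
    have hcg : Continuous (gradient φ) :=
      (InnerProductSpace.toDual ℝ Plane).symm.continuous.comp (hφ.continuous_fderiv one_ne_zero)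
    obtain ⟨C, hC⟩ := (hc.fderiv (𝕜 := ℝ)).exists_bound_of_continuous
      (hφ.continuous_fderiv one_ne_zero)
    have hC' : ∀ x, ‖gradient φ x‖ ≤ C := fun x ↦ by
      rw [gradient, LinearIsometryEquiv.norm_map]; exact hC x
    have hI : ∀ n, Integrable fun x ↦ dyadicLayer w L n x • gradient φ x :=
      fun n ↦ (hint n).smul_of_top_left
        (memLp_top_of_bound hcg.aestronglyMeasurable C (Eventually.of_forall hC'))
    have hs' : Summable fun n ↦ ∫ x, ‖dyadicLayer w L n x • gradient φ x‖ := by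
      refine Summable.of_nonneg_of_le (fun n ↦ integral_nonneg fun x ↦ norm_nonneg _)
        (fun n ↦ ?_) (hsum.mul_right C)
      rw [← integral_mul_const]
      refine integral_mono (hI n).norm ((hint n).norm.mul_const C) fun x ↦ ?_
      simp only [norm_smul]
      gcongr
      exact hC' x
    have h1 := hasSum_integral_of_summable_integral_norm hI hs'
    have h2 : ∫ x, ∑' n, dyadicLayer w L n x • gradient φ x =
        ∫ x, (∑' n, dyadicLayer w L n x) • gradient φ x := by
      refine integral_congr_ae ?_
      filter_upwards [hae] with x hx
      exact (hx.of_norm.hasSum.smul_const _).tsum_eq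
    rw [h2] at h1
    have h3 := ((rotPerp.continuous_of_finiteDimensional.tendsto _).comp h1.tendsto_sum_nat)
    -- The partial sums telescope, and the polygon of level `0` is the chord.
    have h4 : (⇑rotPerp ∘ fun n ↦ ∑ i ∈ Finset.range n,
        ∫ x, dyadicLayer w L i x • gradient φ x) =
        fun n ↦ polygonIntegral φ w L n - segmentIntegral φ (w 0) (w L) := by
      ext1 n
      simp only [Function.comp_apply, map_sum, rotPerp_integral_dyadicLayer w L _ hφ hc]
      rw [Finset.sum_range_sub]
      simp [polygonIntegral, dyadicVertex]
    rw [h4] at h3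
    exact tendsto_nhds_unique h3 ((hw.tendsto_polygonIntegral hL hK).sub_const _)

end LipschitzCurve

/-! ### Length against Hausdorff measure for simple curves. -/

/-- The distance to `x` is 1-Lipschitz and, by connectedness, takes all values in `[0, r)` on `K ∩
ball x r`. -/
lemma IsPreconnected.ofReal_le_hausdorffMeasure_inter_ball {X : Type*} [MetricSpace X]
    [MeasurableSpace X] [BorelSpace X] {K : Set X} (hK : IsPreconnected K) {x y : X}
    (hx : x ∈ K) (hy : y ∈ K) {r : ℝ} (hr : r ≤ dist x y) :
    ENNReal.ofReal r ≤ μH[1] (K ∩ Metric.ball x r) := by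
  have hlip : LipschitzWith 1 (fun z ↦ dist x z) := LipschitzWith.dist_right x
  have himg : Ico 0 r ⊆ (fun z ↦ dist x z) '' (K ∩ Metric.ball x r) := by
    intro a ha
    have h := hK.intermediate_value hx hy (f := fun z ↦ dist x z) hlip.continuous.continuousOn
    obtain ⟨z, hz, rfl⟩ := h ⟨by simpa using ha.1, ha.2.le.trans hr⟩
    exact ⟨z, ⟨hz, by rw [Metric.mem_ball, dist_comm]; exact ha.2⟩, rfl⟩
  calc ENNReal.ofReal r = volume (Ico 0 r) := by simp
    _ = μH[1] (Ico 0 r) := by rw [hausdorffMeasure_real]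
    _ ≤ μH[1] ((fun z ↦ dist x z) '' (K ∩ Metric.ball x r)) := measure_mono himg
    _ ≤ _ := by simpa using hlip.hausdorffMeasure_image_le zero_le_one (K ∩ Metric.ball x r)

lemma eVariationOn_le_of_edist_le {α E F : Type*} [LinearOrder α] [PseudoEMetricSpace E]
    [PseudoEMetricSpace F] {f : α → E} {g : α → F} {s : Set α}
    (h : ∀ x ∈ s, ∀ y ∈ s, x ≤ y → edist (f y) (f x) ≤ edist (g y) (g x)) :
    eVariationOn f s ≤ eVariationOn g s := by
  unfold eVariationOn
  refine iSup_mono fun p ↦ Finset.sum_le_sum fun i _ ↦ ?_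
  exact h _ (p.2.2.2 _) _ (p.2.2.2 _) (p.2.2.1 (Nat.le_succ i))

/-- The one-sided jumps of the variation function are those of `f`, hence zero. -/
lemma LocallyBoundedVariationOn.continuousOn_variationOnFromTo {E : Type*} [PseudoMetricSpace E]
    {f : ℝ → E} {s : Set ℝ} (hf : LocallyBoundedVariationOn f s) (hc : ContinuousOn f s) {a : ℝ}
    (ha : a ∈ s) : ContinuousOn (variationOnFromTo f s a) s := by
  intro b hb
  have hl := variationOnFromTo.tendsto_left ha hb hf
    ((hc b hb).mono_left (nhdsWithin_mono _ inter_subset_left))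
  have hr := variationOnFromTo.tendsto_right ha hb hf
    ((hc b hb).mono_left (nhdsWithin_mono _ inter_subset_left))
  rw [dist_self, sub_zero] at hl
  rw [dist_self, add_zero] at hr
  have h1 : ContinuousWithinAt (variationOnFromTo f s a) (s ∩ Iio b) b := hl
  have h2 : ContinuousWithinAt (variationOnFromTo f s a) (s ∩ Ioi b) b := hr
  have h3 := (h1.union h2).union (continuousWithinAt_singleton (x := b))
  refine h3.mono fun x hx ↦ ?_
  rcases lt_trichotomy x b with h | h | h
  · exact Or.inl (Or.inl ⟨hx, h⟩)
  · exact Or.inr h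
  · exact Or.inl (Or.inr ⟨hx, h⟩)

namespace IsSimpleRectifiableCurve

variable {c : ℝ → Plane} {P R : Plane}

lemma isCompact_curveSupport (hc : IsSimpleRectifiableCurve c P R) :
    IsCompact (curveSupport c) := isCompact_Icc.image_of_continuousOn hc.continuousOn

lemma isPreconnected_curveSupport (hc : IsSimpleRectifiableCurve c P R) :
    IsPreconnected (curveSupport c) := isPreconnected_Icc.image _ hc.continuousOn

lemma locallyBoundedVariationOn (hc : IsSimpleRectifiableCurve c P R) :
    LocallyBoundedVariationOn c (Icc 0 1) :=
  BoundedVariationOn.locallyBoundedVariationOn hc.finite_length.ne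

lemma eq_of_mem_Ioo (hc : IsSimpleRectifiableCurve c P R) {s t : ℝ} (hs : s ∈ Icc (0 : ℝ) 1)
    (ht : t ∈ Ioo (0 : ℝ) 1) (h : c s = c t) : s = t := by
  rcases lt_trichotomy s t with hst | hst | hst
  · have := (hc.simple s hs t (Ioo_subset_Icc_self ht) hst h).2
    linarith [ht.2]
  · exact hst
  · have := (hc.simple t (Ioo_subset_Icc_self ht) s hs hst h.symm).1
    linarith [ht.1]

/-- Open arcs are used because they stay disjoint over the intervals of a partition, even for a
closed curve; the endpoints are `ℋ¹`-null. -/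
lemma edist_le_hausdorffMeasure_image_Ioo (hc : IsSimpleRectifiableCurve c P R) {s t : ℝ}
    (hs : 0 ≤ s) (hst : s ≤ t) (ht : t ≤ 1) : edist (c s) (c t) ≤ μH[1] (c '' Ioo s t) := by
  have : NullSingletonClass (μH[1] : Measure Plane) :=
    Measure.nullSingletonClass_hausdorff Plane one_pos
  have hpre : IsPreconnected (c '' Icc s t) :=
    isPreconnected_Icc.image _ (hc.continuousOn.mono (Icc_subset_Icc hs ht))
  have h := hpre.ofReal_le_hausdorffMeasure_inter_ball (mem_image_of_mem c ⟨le_rfl, hst⟩)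
    (mem_image_of_mem c ⟨hst, le_rfl⟩) le_rfl
  rw [edist_dist]
  refine h.trans ((measure_mono (t := c '' Ioo s t ∪ {c s, c t}) ?_).trans
    ((measure_union_le _ _).trans ?_))
  · rintro x ⟨⟨a, ha, rfl⟩, -⟩
    rcases eq_or_lt_of_le ha.1 with h1 | h1
    · right; left; rw [h1]
    rcases eq_or_lt_of_le ha.2 with h2 | h2
    · right; right; rw [h2]; rfl
    exact Or.inl ⟨a, ⟨h1, h2⟩, rfl⟩
  · rw [(Set.toFinite {c s, c t}).measure_zero, add_zero]

/-- By simplicity the open arcs of a partition are disjoint, and each has `ℋ¹`-measure at least its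
chord. -/
lemma eVariationOn_le_hausdorffMeasure (hc : IsSimpleRectifiableCurve c P R) :
    eVariationOn c (Icc 0 1) ≤ μH[1] (curveSupport c) := by
  refine iSup_le ?_
  rintro ⟨n, u, hu, hmem⟩
  simp only
  calc ∑ i ∈ Finset.range n, edist (c (u (i + 1))) (c (u i))
      ≤ ∑ i ∈ Finset.range n, μH[1] (c '' Ioo (u i) (u (i + 1))) := by
        refine Finset.sum_le_sum fun i _ ↦ ?_
        rw [edist_comm]
        exact hc.edist_le_hausdorffMeasure_image_Ioo (hmem i).1 (hu (Nat.le_succ i))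
          (hmem (i + 1)).2
    _ = μH[1] (⋃ i ∈ Finset.range n, c '' Ioo (u i) (u (i + 1))) := by
        refine (measure_biUnion_finset ?_ fun i _ ↦ ?_).symm
        · intro i _ j _ hij
          rw [Function.onFun, Set.disjoint_left]
          rintro _ ⟨a, ha, rfl⟩ ⟨b, hb, hab⟩
          have ha' : a ∈ Ioo (0 : ℝ) 1 := ⟨(hmem i).1.trans_lt ha.1, ha.2.trans_le (hmem _).2⟩
          have hb' : b ∈ Icc (0 : ℝ) 1 := ⟨(hmem j).1.trans hb.1.le, hb.2.le.trans (hmem _).2⟩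
          have hba := hc.eq_of_mem_Ioo hb' ha' hab
          subst hba
          rcases lt_or_gt_of_ne hij with h | h
          · exact absurd (hu (Nat.succ_le_of_lt h)) (not_le.2 (hb.1.trans ha.2))
          · exact absurd (hu (Nat.succ_le_of_lt h)) (not_le.2 (ha.1.trans hb.2))
        · have hsub : Ioo (u i) (u (i + 1)) ⊆ Ioo 0 1 := Ioo_subset_Ioo (hmem i).1 (hmem _).2
          refine measurableSet_Ioo.image_of_continuousOn_injOn
            (hc.continuousOn.mono (hsub.trans Ioo_subset_Icc_self)) fun a ha b hb h ↦ ?_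
          exact hc.eq_of_mem_Ioo (Ioo_subset_Icc_self (hsub ha)) (hsub hb) h
    _ ≤ _ := by
        refine measure_mono (iUnion₂_subset fun i _ ↦ image_mono ?_)
        exact fun a ha ↦ ⟨(hmem i).1.trans ha.1.le, ha.2.le.trans (hmem _).2⟩

end IsSimpleRectifiableCurve

/-! ### Arc-length parametrization and tangent fields. -/

section UnitSpeed

variable {w : ℝ → Plane} {L : ℝ}

lemma HasUnitSpeedOn.lipschitzOnWith (h : HasUnitSpeedOn w (Icc 0 L)) :
    LipschitzOnWith 1 w (Icc 0 L) := by
  have key : ∀ x ∈ Icc 0 L, ∀ y ∈ Icc 0 L, x ≤ y → edist (w x) (w y) ≤ edist x y := by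
    intro x hx y hy hxy
    have h1 := eVariationOn.edist_le w (s := Icc 0 L ∩ Icc x y)
      ⟨hx, ⟨le_rfl, hxy⟩⟩ ⟨hy, ⟨hxy, le_rfl⟩⟩
    rw [h hx hy] at h1
    rwa [edist_comm x, edist_dist y, Real.dist_eq, abs_of_nonneg (sub_nonneg.2 hxy),
      ← one_mul (y - x)]
  intro x hx y hy
  rw [ENNReal.coe_one, one_mul]
  rcases le_total x y with hxy | hxy
  · exact key x hx y hy hxy
  · rw [edist_comm, edist_comm x]
    exact key y hy x hx hxy

/-- The speed is at most `1`, while its primitive `G` dominates the variation of `w`, so its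
integral is at least `L`. Equality must hold almost everywhere. -/
lemma HasUnitSpeedOn.ae_norm_deriv_eq_one (h : HasUnitSpeedOn w (Icc 0 L)) (hL : 0 ≤ L) :
    ∀ᵐ s ∂volume.restrict (Ioc 0 L), ‖deriv w s‖ = 1 := by
  have hw := h.lipschitzOnWith
  have hI : ∀ a b, 0 ≤ a → a ≤ b → b ≤ L →
      IntervalIntegrable (fun s ↦ ‖deriv w s‖) volume a b := fun a b ha hab hb ↦ by
    simpa using (hw.intervalIntegrable_smul_deriv (f := fun _ ↦ 1)
      continuousOn_const ha hab hb).norm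
  set G : ℝ → ℝ := fun t ↦ ∫ s in (0 : ℝ)..t, ‖deriv w s‖ with hG
  have hsub : ∀ x ∈ Icc 0 L, ∀ y ∈ Icc 0 L, x ≤ y → dist (w y) (w x) ≤ G y - G x := by
    intro x hx y hy hxy
    have : G y - G x = ∫ s in x..y, ‖deriv w s‖ :=
      intervalIntegral.integral_interval_sub_left (hI _ _ le_rfl hy.1 hy.2)
        (hI _ _ le_rfl hx.1 hx.2)
    rw [this, dist_eq_norm, ← hw.integral_deriv_eq_sub_of_le hx.1 hxy hy.2]
    exact intervalIntegral.norm_integral_le_integral_norm hxy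
  have hmono : MonotoneOn G (Icc 0 L) := fun x hx y hy hxy ↦
    sub_nonneg.1 (dist_nonneg.trans (hsub x hx y hy hxy))
  have hle : L ≤ ∫ s in (0 : ℝ)..L, ‖deriv w s‖ := by
    have h0 : (0 : ℝ) ∈ Icc 0 L := ⟨le_rfl, hL⟩
    have h1 : L ∈ Icc 0 L := ⟨hL, le_rfl⟩
    have hv := h h0 h1
    rw [inter_self] at hv
    have h2 : eVariationOn w (Icc 0 L) ≤ eVariationOn G (Icc 0 L) :=
      eVariationOn_le_of_edist_le fun x hx y hy hxy ↦ by
        rw [edist_dist, edist_dist, Real.dist_eq,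
          abs_of_nonneg (sub_nonneg.2 (hmono hx hy hxy))]
        exact ENNReal.ofReal_le_ofReal (hsub x hx y hy hxy)
    have h3 := (hmono.eVariationOn_eq h0 h1).le
    rw [inter_self] at h3
    have h4 := (hv.symm.le.trans h2).trans h3
    rw [ENNReal.ofReal_le_ofReal_iff (sub_nonneg.2 (hmono h0 h1 hL))] at h4
    simpa [hG] using h4
  have hle1 : ∀ᵐ s ∂volume.restrict (Ioc 0 L), 0 ≤ 1 - ‖deriv w s‖ := by
    refine (ae_restrict_iff' measurableSet_Ioc).2 ?_
    filter_upwards [ae_mem_Ioo_of_mem_Icc 0 L] with s hs hs'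
    exact sub_nonneg.2 (hw.norm_deriv_le_one_of_mem_Ioo (hs (Ioc_subset_Icc_self hs')))
  have hint : IntegrableOn (fun s ↦ 1 - ‖deriv w s‖) (Ioc 0 L) :=
    (intervalIntegrable_iff_integrableOn_Ioc_of_le hL).1
      (intervalIntegrable_const.sub (hI 0 L le_rfl hL le_rfl))
  have hzero : ∫ s in Ioc 0 L, (1 - ‖deriv w s‖) = 0 := by
    refine le_antisymm ?_ (integral_nonneg_of_ae hle1)
    rw [← intervalIntegral.integral_of_le hL, intervalIntegral.integral_sub
      intervalIntegrable_const (hI 0 L le_rfl hL le_rfl)]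
    simpa using hle
  filter_upwards [(integral_eq_zero_iff_of_nonneg_ae hle1 hint).1 hzero] with s hs
  simp only [Pi.zero_apply] at hs
  linarith

/-- A curve of unit speed whose image has the length of the curve as its `ℋ¹`-measure transports
Lebesgue measure to `ℋ¹`. -/
lemma LipschitzOnWith.map_volume_eq_hausdorffMeasure (hw : LipschitzOnWith 1 w (Icc 0 L))
    (hle : ENNReal.ofReal L ≤ μH[1] (w '' Icc 0 L)) :
    (volume.restrict (Icc 0 L)).map w = (μH[1]).restrict (w '' Icc 0 L) := by
  have hm : AEMeasurable w (volume.restrict (Icc 0 L)) :=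
    hw.continuousOn.aemeasurable measurableSet_Icc
  have hbound : ∀ A ⊆ Icc 0 L, μH[1] (w '' A) ≤ volume A := fun A hA ↦ by
    simpa [hausdorffMeasure_real] using (hw.mono hA).hausdorffMeasure_image_le zero_le_one
  have hfin : μH[1] (w '' Icc 0 L) ≤ ENNReal.ofReal L := by
    simpa using hbound _ Subset.rfl
  have : IsFiniteMeasure ((μH[1] : Measure Plane).restrict (w '' Icc 0 L)) :=
    isFiniteMeasure_restrict.2 (hfin.trans_lt ENNReal.ofReal_lt_top).ne
  have : IsFiniteMeasure ((volume.restrict (Icc 0 L)).map w) := inferInstance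
  -- A 1-Lipschitz map does not increase `ℋ¹`, which gives one inequality between finite measures;
  -- `hle` makes the total masses equal.
  refine (Measure.eq_of_le_of_measure_univ_eq ?_ ?_).symm
  · refine Measure.le_iff.2 fun A hA ↦ ?_
    rw [Measure.restrict_apply hA, Measure.map_apply_of_aemeasurable hm hA]
    have h0 : NullMeasurableSet (w ⁻¹' A) (volume.restrict (Icc 0 L)) :=
      hm.nullMeasurableSet_preimage hA
    rw [Measure.restrict_apply₀ h0]
    refine (measure_mono ?_).trans (hbound (w ⁻¹' A ∩ Icc 0 L) inter_subset_right)
    rintro _ ⟨hx, s, hs, rfl⟩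
    exact ⟨s, ⟨hx, hs⟩, rfl⟩
  · rw [Measure.restrict_apply_univ, Measure.map_apply_of_aemeasurable hm MeasurableSet.univ,
      preimage_univ, Measure.restrict_apply_univ, Real.volume_Icc, sub_zero]
    exact le_antisymm hfin hle

end UnitSpeed

namespace IsSimpleRectifiableCurve

variable {c : ℝ → Plane} {P R : Plane} {τ : Plane → Plane}

/-- The direction of a unit tangent vector is the derivative of any parametrization of unit
speed. -/
lemma deriv_eq_of_isOrientedUnitTangent (hc : IsSimpleRectifiableCurve c P R)
    {w : ℝ → Plane} {V : ℝ → ℝ} (hV : ContinuousOn V (Icc 0 1)) (hVm : MonotoneOn V (Icc 0 1))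
    (hwV : ∀ s ∈ Icc (0 : ℝ) 1, w (V s) = c s) {t : ℝ} (ht : t ∈ Ioo (0 : ℝ) 1) {d v : Plane}
    (hd : HasDerivAt w d (V t)) (hd1 : ‖d‖ = 1) (hv : IsOrientedUnitTangent c t v) : d = v := by
  have htI := Ioo_subset_Icc_self ht
  have hnhds : ∀ᶠ s in 𝓝[≠] t, s ∈ Icc (0 : ℝ) 1 ∧ s ≠ t := by
    filter_upwards [nhdsWithin_le_nhds (Icc_mem_nhds ht.1 ht.2), self_mem_nhdsWithin] with s h1 h2
    exact ⟨h1, h2⟩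
  have hne : ∀ s ∈ Icc (0 : ℝ) 1, s ≠ t → V s ≠ V t := by
    intro s hs hst h
    exact hst (hc.eq_of_mem_Ioo hs ht (by rw [← hwV s hs, ← hwV t htI, h]))
  have hVt : Tendsto V (𝓝[≠] t) (𝓝[≠] (V t)) := by
    refine tendsto_nhdsWithin_iff.2 ⟨?_, ?_⟩
    · exact ((hV t htI).continuousAt (Icc_mem_nhds ht.1 ht.2)).mono_left nhdsWithin_le_nhds
    · filter_upwards [hnhds] with s hs
      exact hne s hs.1 hs.2
  have hslope := (hasDerivAt_iff_tendsto_slope.1 hd).comp hVt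
  have hnorm : Tendsto (fun s ↦ ‖slope w (V t) (V s)‖⁻¹ • slope w (V t) (V s)) (𝓝[≠] t)
      (𝓝 (‖d‖⁻¹ • d)) :=
    (hslope.norm.inv₀ (by rw [hd1]; exact one_ne_zero)).smul hslope
  rw [hd1, inv_one, one_smul] at hnorm
  refine tendsto_nhds_unique (hnorm.congr' ?_) hv
  filter_upwards [hnhds] with s hs
  rw [slope_def_module, hwV s hs.1, hwV t htI, norm_smul, mul_inv, smul_smul, smul_smul, norm_inv,
    inv_inv, Real.norm_eq_abs, mul_right_comm]
  congr 2
  -- `V` is monotone and takes the value `V t` only at `t`, so `V s - V t` and `s - t` have the same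
  -- sign.
  rcases lt_or_gt_of_ne hs.2 with h | h
  · have h1 : V s - V t < 0 :=
      sub_neg.2 (lt_of_le_of_ne (hVm hs.1 htI h.le) (hne s hs.1 hs.2))
    have h2 : s - t < 0 := sub_neg.2 h
    rw [abs_of_neg h1, abs_of_neg h2, div_neg, div_self h2.ne, neg_mul, mul_inv_cancel₀ h1.ne]
  · have h1 : 0 < V s - V t :=
      sub_pos.2 (lt_of_le_of_ne (hVm htI hs.1 h.le) (hne s hs.1 hs.2).symm)
    have h2 : 0 < s - t := sub_pos.2 h
    rw [abs_of_pos h1, abs_of_pos h2, div_self h2.ne', mul_inv_cancel₀ h1.ne']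

/-- A simple rectifiable curve has finite `ℋ¹`-measure, and integrals against its tangent field
are line integrals along a Lipschitz parametrization. -/
lemma exists_lipschitz_parametrization (hc : IsSimpleRectifiableCurve c P R)
    (hτ : IsOrientedBy c τ) :
    μH[1] (curveSupport c) ≠ ⊤ ∧
    ∃ (L : ℝ) (w : ℝ → Plane), 0 ≤ L ∧ LipschitzOnWith 1 w (Icc 0 L) ∧ w 0 = P ∧ w L = R ∧
      ∀ φ : Plane → ℝ, Continuous φ →
        ∫ x in curveSupport c, φ x • τ x ∂μH[1] = ∫ s in (0 : ℝ)..L, φ (w s) • deriv w s := by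
  have h0 : (0 : ℝ) ∈ Icc (0 : ℝ) 1 := ⟨le_rfl, zero_le_one⟩
  have h1 : (1 : ℝ) ∈ Icc (0 : ℝ) 1 := ⟨zero_le_one, le_rfl⟩
  have hbv := hc.locallyBoundedVariationOn
  set V := variationOnFromTo c (Icc 0 1) 0 with hVdef
  have hVc : ContinuousOn V (Icc 0 1) := hbv.continuousOn_variationOnFromTo hc.continuousOn h0
  have hVm : MonotoneOn V (Icc 0 1) := variationOnFromTo.monotoneOn hbv h0
  have hV0 : V 0 = 0 := variationOnFromTo.self _ _ _
  set L := V 1 with hLdef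
  have hL : 0 ≤ L := hV0 ▸ hVm h0 h1 zero_le_one
  have hLlen : ENNReal.ofReal L = eVariationOn c (Icc 0 1) := by
    rw [hLdef, hVdef, variationOnFromTo.eq_of_le _ _ zero_le_one, inter_self,
      ENNReal.ofReal_toReal hc.finite_length.ne]
  have himg : V '' Icc 0 1 = Icc 0 L := by
    refine Subset.antisymm ?_ ?_
    swap
    · have := intermediate_value_Icc zero_le_one hVc
      rwa [hV0] at this
    rintro _ ⟨t, ht, rfl⟩
    exact ⟨hV0 ▸ hVm h0 ht ht.1, hVm ht h1 ht.2⟩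
  set w := naturalParameterization c (Icc 0 1) 0 with hwdef
  have hwV : ∀ s ∈ Icc (0 : ℝ) 1, w (V s) = c s := fun s hs ↦
    edist_eq_zero.1 (edist_naturalParameterization_eq_zero hbv h0 hs)
  have hspeed : HasUnitSpeedOn w (Icc 0 L) := by
    rw [← himg]; exact has_unit_speed_naturalParameterization c hbv h0
  have hw := hspeed.lipschitzOnWith
  have hsupp : curveSupport c = w '' Icc 0 L := by
    rw [← himg, image_image]
    exact (image_congr hwV).symm
  have hle : ENNReal.ofReal L ≤ μH[1] (w '' Icc 0 L) := by
    rw [← hsupp, hLlen]; exact hc.eVariationOn_le_hausdorffMeasure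
  have hmap := hw.map_volume_eq_hausdorffMeasure hle
  rw [← hsupp] at hmap
  have hm : AEMeasurable w (volume.restrict (Icc 0 L)) :=
    hw.continuousOn.aemeasurable measurableSet_Icc
  refine ⟨?_, L, w, hL, hw, ?_, ?_, fun φ hφ ↦ ?_⟩
  · rw [hsupp]
    refine (lt_of_le_of_lt (hw.hausdorffMeasure_image_le zero_le_one) ?_).ne
    simp [hausdorffMeasure_real]
  · rw [← hV0, hwV 0 h0, hc.source]
  · rw [hLdef, hwV 1 h1, hc.target]
  · have htan : ∀ᵐ s ∂volume.restrict (Icc 0 L),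
        ∃ t ∈ Ioo (0 : ℝ) 1, c t = w s ∧ IsOrientedUnitTangent c t (τ (w s)) := by
      have := hτ.tangent
      rw [← hmap] at this
      exact ae_of_ae_map hm this
    rw [← hmap, integral_map hm]
    · rw [intervalIntegral.integral_of_le hL, ← integral_Icc_eq_integral_Ioc]
      refine integral_congr_ae ?_
      have hone := hspeed.ae_norm_deriv_eq_one hL
      rw [Measure.restrict_congr_set Ioc_ae_eq_Icc] at hone
      filter_upwards [htan, hone, ae_restrict_mem measurableSet_Icc,
        ae_restrict_of_ae (ae_mem_Ioo_of_mem_Icc 0 L),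
        ae_restrict_of_ae hw.ae_differentiableAt_Ioo] with s hs hs1 hsI hsO hsd
      -- The tangent is known at some interior parameter `t` over the point `w s`; simplicity
      -- identifies it with the parameter `t'` for which `V t' = s`.
      obtain ⟨t, ht, hts, htan⟩ := hs
      obtain ⟨t', ht', rfl⟩ : s ∈ V '' Icc 0 1 := himg ▸ hsI
      have : t' = t := hc.eq_of_mem_Ioo ht' ht (by rw [hts, hwV t' ht'])
      subst this
      rw [hc.deriv_eq_of_isOrientedUnitTangent hVc hVm hwV ht (hsd (hsO hsI)).hasDerivAt hs1 htan]
    · rw [hmap]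
      exact hφ.aestronglyMeasurable.smul hτ.measurable

end IsSimpleRectifiableCurve

/-! ### Vector measures with a density. -/

section WithDensity

variable {X E : Type*} [MeasurableSpace X] [NormedAddCommGroup E] [NormedSpace ℝ E]
  [CompleteSpace E] {μ : Measure X} {θ : X → E}

lemma isFiniteMeasure_variation_withDensityᵥ (hθ : Integrable θ μ) :
    IsFiniteMeasure (μ.withDensityᵥ θ).variation := by
  rw [Measure.variation_withDensityᵥ hθ]
  exact ⟨by rw [withDensity_apply _ MeasurableSet.univ, Measure.restrict_univ]; exact hθ.2⟩

/-- Integration of a bounded function against a vector measure with a density. -/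
lemma integral_withDensityᵥ (hθ : Integrable θ μ) {φ : X → ℝ} (hφ : StronglyMeasurable φ)
    {C : ℝ} (hC : ∀ x, ‖φ x‖ ≤ C) :
    ∫ᵛ x, φ x ∂•(μ.withDensityᵥ θ) = ∫ x, φ x • θ x ∂μ := by
  have := isFiniteMeasure_variation_withDensityᵥ hθ
  have hsimple : ∀ f : SimpleFunc X ℝ,
      ∫ᵛ x, f x ∂•(μ.withDensityᵥ θ) = ∫ x, f x • θ x ∂μ := by
    intro f
    induction f using SimpleFunc.induction with
    | @const c s hs =>
      have h1 : ⇑(SimpleFunc.piecewise s hs (SimpleFunc.const X c) (SimpleFunc.const X 0)) =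
          s.indicator fun _ ↦ c := by ext; simp [indicator]
      have h2 : (fun x ↦ s.indicator (fun _ ↦ c) x • θ x) = s.indicator fun x ↦ c • θ x := by
        ext x
        by_cases hx : x ∈ s <;> simp [hx]
      rw [h1, VectorMeasure.integral_indicator_const c hs, h2, integral_indicator hs,
        integral_smul, withDensityᵥ_apply hθ hs]
      rfl
    | @add f g _ hf hg =>
      have hI : ∀ f : SimpleFunc X ℝ, Integrable (fun x ↦ f x • θ x) μ := by
        intro f
        obtain ⟨C, hC⟩ := f.exists_forall_norm_le
        exact hθ.smul_of_top_right (memLp_top_of_bound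
          f.stronglyMeasurable.aestronglyMeasurable C (Eventually.of_forall hC))
      simp only [SimpleFunc.coe_add, Pi.add_apply, add_smul]
      rw [integral_add (hI f) (hI g), ← hf, ← hg]
      exact VectorMeasure.integral_fun_add
        (SimpleFunc.integrable_of_isFiniteMeasure f) (SimpleFunc.integrable_of_isFiniteMeasure g)
  -- A point is needed to know that `C` is nonnegative.
  rcases isEmpty_or_nonempty X with hX | ⟨⟨x₀⟩⟩
  · have : φ = (0 : SimpleFunc X ℝ) := Subsingleton.elim _ _
    rw [this]
    exact hsimple _
  have hC0 : 0 ≤ C := (norm_nonneg _).trans (hC x₀)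
  have hlim : ∀ x, Tendsto (fun n ↦ hφ.approxBounded C n x) atTop (𝓝 (φ x)) := fun x ↦
    hφ.tendsto_approxBounded_of_norm_le (hC x)
  have h1 : Tendsto (fun n ↦ ∫ᵛ x, hφ.approxBounded C n x ∂•(μ.withDensityᵥ θ)) atTop
      (𝓝 (∫ᵛ x, φ x ∂•(μ.withDensityᵥ θ))) :=
    VectorMeasure.tendsto_integral_of_dominated_convergence (fun _ ↦ C)
      (fun n ↦ (hφ.approxBounded C n).stronglyMeasurable.aestronglyMeasurable)
      (integrable_const C) (fun n ↦ Eventually.of_forall (hφ.norm_approxBounded_le hC0 n))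
      (Eventually.of_forall hlim)
  have h2 : Tendsto (fun n ↦ ∫ x, hφ.approxBounded C n x • θ x ∂μ) atTop
      (𝓝 (∫ x, φ x • θ x ∂μ)) := by
    refine tendsto_integral_of_dominated_convergence (fun x ↦ C * ‖θ x‖) (fun n ↦ ?_)
      (hθ.norm.const_mul C) (fun n ↦ Eventually.of_forall fun x ↦ ?_)
      (Eventually.of_forall fun x ↦ (hlim x).smul_const _)
    · exact (hφ.approxBounded C n).stronglyMeasurable.aestronglyMeasurable.smul hθ.1
    · rw [norm_smul]
      gcongr
      exact hφ.norm_approxBounded_le hC0 n x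
  simp_rw [hsimple] at h1
  exact tendsto_nhds_unique h1 h2

end WithDensity

/-- Brings the measures of both curves to a common base measure, `ℋ¹` on their union, so that the
difference has one density. -/
lemma restrict_withDensityᵥ_eq_indicator {X E : Type*} [MeasurableSpace X]
    [NormedAddCommGroup E] [NormedSpace ℝ E] {ν : Measure X} {θ : X → E} {A B : Set X} (hA : MeasurableSet A)
    (hAB : A ⊆ B) (hθ : IntegrableOn θ A ν) :
    (ν.restrict A).withDensityᵥ θ = (ν.restrict B).withDensityᵥ (A.indicator θ) := by
  have hr : (ν.restrict B).restrict A = ν.restrict A := by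
    rw [Measure.restrict_restrict hA, inter_eq_self_of_subset_left hAB]
  have hi : Integrable (A.indicator θ) (ν.restrict B) := by
    rw [integrable_indicator_iff hA, IntegrableOn, hr]
    exact hθ
  ext s hs
  rw [withDensityᵥ_apply hθ hs, withDensityᵥ_apply hi hs, setIntegral_indicator hA,
    Measure.restrict_restrict hs, Measure.restrict_restrict (hs.inter hA)]
  congr 2
  grind

/-! ### Vanishing of the gradient measure off the approximate discontinuity set. -/

/-- Allows a constant to be subtracted from `u` when testing its gradient. -/
lemma integral_gradient_eq_zero {φ : Plane → ℝ} (hφ : ContDiff ℝ 1 φ) (hc : HasCompactSupport φ) :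
    ∫ x, gradient φ x = 0 := by
  have hcf : Continuous (fderiv ℝ φ) := hφ.continuous_fderiv one_ne_zero
  have hcg : Continuous (gradient φ) :=
    (InnerProductSpace.toDual ℝ Plane).symm.continuous.comp hcf
  have hcs : HasCompactSupport (gradient φ) :=
    (hc.fderiv (𝕜 := ℝ)).comp_left (map_zero _)
  have hint : Integrable (gradient φ) := hcg.integrable_of_hasCompactSupport hcs
  refine ext_inner_left ℝ fun v ↦ ?_
  rw [inner_zero_right, ← integral_inner hint]
  have h1 : ∀ x, inner ℝ v (gradient φ x) = fderiv ℝ φ x v := by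
    intro x
    rw [real_inner_comm, gradient, InnerProductSpace.toDual_symm_apply]
  have hi : Integrable fun x ↦ fderiv ℝ φ x v := by
    simp_rw [← h1]
    exact hint.const_inner v
  simp_rw [h1]
  have h2 := integral_mul_fderiv_eq_neg_fderiv_mul_of_integrable (μ := (volume : Measure Plane))
    (f := fun _ ↦ (1 : ℝ)) (g := φ) (v := v) (by simp) (by simpa using hi)
    (by simpa using hφ.continuous.integrable_of_hasCompactSupport hc)
    (fun x _ ↦ differentiableAt_const _) (fun x _ ↦ hφ.differentiable one_ne_zero x)
  simpa using h2

/-- A measure whose balls at `x` have at least linear growth charges concentric balls comparably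
at arbitrarily small scales. -/
lemma frequently_measureReal_closedBall_two_mul_le {X : Type*} [MetricSpace X] [MeasurableSpace X]
    {μ : Measure X} [IsFiniteMeasure μ] {x : X} {r₀ : ℝ} (hr₀ : 0 < r₀)
    (h : ∀ r ∈ Ioo 0 r₀, r ≤ μ.real (Metric.closedBall x r)) :
    ∃ᶠ r in 𝓝[>] (0 : ℝ), μ.real (Metric.closedBall x (2 * r)) ≤
      4 * μ.real (Metric.closedBall x r) := by
  intro hcon
  obtain ⟨δ, hδ, hsub⟩ := mem_nhdsGT_iff_exists_Ioo_subset.1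
    (inter_mem hcon (Ioo_mem_nhdsGT hr₀))
  have hδ : 0 < δ := hδ
  set m : ℝ → ℝ := fun r ↦ μ.real (Metric.closedBall x r)
  -- If the inequality failed at all small scales, `m` would decay quadratically, against the linear
  -- lower bound. Any factor above `2` in place of `4` would do.
  have hbound : ∀ k : ℕ, 4 ^ k * m (δ / 2 / 2 ^ k) ≤ m (δ / 2) := by
    intro k
    induction k with
    | zero => simp
    | succ k ih =>
      refine le_trans ?_ ih
      have hmem : δ / 2 / 2 ^ (k + 1) ∈ Ioo 0 δ := by
        refine ⟨by positivity, ?_⟩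
        calc δ / 2 / 2 ^ (k + 1) ≤ δ / 2 := div_le_self (by positivity) (one_le_pow₀ (by norm_num))
          _ < δ := by linarith
      have h1 := not_le.1 (hsub hmem).1
      have h2 : 2 * (δ / 2 / 2 ^ (k + 1)) = δ / 2 / 2 ^ k := by
        rw [pow_succ]; field_simp
      rw [h2] at h1
      calc 4 ^ (k + 1) * m (δ / 2 / 2 ^ (k + 1)) = 4 ^ k * (4 * m (δ / 2 / 2 ^ (k + 1))) := by ring
        _ ≤ _ := by gcongr
  have hlow : ∀ k : ℕ, 2 ^ k * (δ / 2) ≤ m (δ / 2) := by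
    intro k
    refine le_trans ?_ (hbound k)
    have hmem : δ / 2 / 2 ^ k ∈ Ioo 0 δ := by
      refine ⟨by positivity, ?_⟩
      calc δ / 2 / 2 ^ k ≤ δ / 2 := div_le_self (by positivity) (one_le_pow₀ (by norm_num))
        _ < δ := by linarith
    calc (2 : ℝ) ^ k * (δ / 2) = 4 ^ k * (δ / 2 / 2 ^ k) := by
          rw [show (4 : ℝ) = 2 * 2 by norm_num, mul_pow]; field_simp
      _ ≤ _ := by gcongr; exact h _ (hsub hmem).2
  have htend : Tendsto (fun k : ℕ ↦ (2 : ℝ) ^ k * (δ / 2)) atTop atTop :=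
    (tendsto_pow_atTop_atTop_of_one_lt (by norm_num)).atTop_mul_const (by positivity)
  obtain ⟨k, hk⟩ := (htend.eventually_gt_atTop (m (δ / 2))).exists
  exact absurd (hlow k) (not_le.2 hk)

/-- Rescaled bump functions with a gradient bounded by the inverse of the scale. -/
lemma exists_bump_gradient_le : ∃ C : ℝ, 0 ≤ C ∧ ∀ (x : Plane) (r : ℝ), 0 < r →
    ∃ φ : Plane → ℝ, ContDiff ℝ ∞ φ ∧ HasCompactSupport φ ∧ (∀ y, 0 ≤ φ y) ∧ (∀ y, φ y ≤ 1) ∧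
      (∀ y ∈ Metric.closedBall x r, φ y = 1) ∧ (∀ y ∉ Metric.ball x (2 * r), φ y = 0) ∧
      (∀ y, ‖gradient φ y‖ ≤ C / r) ∧ ∀ y ∉ Metric.ball x (2 * r), gradient φ y = 0 := by
  -- The outer radius `3 / 2 < 2` makes the rescaled bump vanish near every point outside the open
  -- ball of radius `2 * r`, so its gradient vanishes there too.
  let ψ : ContDiffBump (0 : Plane) := ⟨1, 3 / 2, one_pos, by norm_num⟩
  have hψ : ContDiff ℝ 1 ψ := ψ.contDiff
  obtain ⟨C, hC⟩ := (ψ.hasCompactSupport.fderiv (𝕜 := ℝ)).exists_bound_of_continuous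
    (hψ.continuous_fderiv one_ne_zero)
  refine ⟨C, (norm_nonneg _).trans (hC 0), fun x r hr ↦ ?_⟩
  have hnorm : ∀ y, ‖r⁻¹ • (y - x)‖ = dist y x / r := fun y ↦ by
    rw [norm_smul, norm_inv, Real.norm_of_nonneg hr.le, dist_eq_norm]
    ring
  have hzero : ∀ y, 3 / 2 * r ≤ dist y x → ψ (r⁻¹ • (y - x)) = 0 := fun y hy ↦ by
    refine ψ.zero_of_le_dist ?_
    rw [dist_zero_right, hnorm, le_div_iff₀ hr]
    exact hy
  have hder : ∀ y, HasFDerivAt (fun y ↦ ψ (r⁻¹ • (y - x)))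
      (r⁻¹ • fderiv ℝ ψ (r⁻¹ • (y - x))) y := fun y ↦ by
    have h1 : HasFDerivAt (fun y : Plane ↦ r⁻¹ • (y - x))
        (r⁻¹ • ContinuousLinearMap.id ℝ Plane) y :=
      ((hasFDerivAt_id y).sub_const x).const_smul r⁻¹
    have h2 := ((hψ.differentiable one_ne_zero (r⁻¹ • (y - x))).hasFDerivAt).comp y h1
    have h3 : fderiv ℝ ψ (r⁻¹ • (y - x)) ∘L (r⁻¹ • ContinuousLinearMap.id ℝ Plane) =
        r⁻¹ • fderiv ℝ ψ (r⁻¹ • (y - x)) := by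
      ext v
      simp
    rw [h3] at h2
    exact h2
  have hsm : ContDiff ℝ ∞ fun y ↦ ψ (r⁻¹ • (y - x)) :=
    ψ.contDiff.comp ((contDiff_id.sub contDiff_const).const_smul r⁻¹)
  have hgrad0 : ∀ y ∉ Metric.ball x (2 * r), gradient (fun y ↦ ψ (r⁻¹ • (y - x))) y = 0 := by
    intro y hy
    have h1 : (fun y ↦ ψ (r⁻¹ • (y - x))) =ᶠ[𝓝 y] fun _ ↦ 0 := by
      have h2 : 3 / 2 * r < dist y x := by
        rw [Metric.mem_ball, not_lt] at hy
        linarith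
      filter_upwards [(continuous_id.dist continuous_const).continuousAt.eventually
        (lt_mem_nhds h2)] with z hz
      exact hzero z (le_of_lt hz)
    rw [gradient, h1.fderiv_eq]
    simp
  refine ⟨fun y ↦ ψ (r⁻¹ • (y - x)), hsm, ?_, fun y ↦ ψ.nonneg, fun y ↦ ψ.le_one, ?_, ?_, ?_,
    hgrad0⟩
  · refine HasCompactSupport.of_support_subset_isCompact (isCompact_closedBall x (2 * r)) ?_
    intro y hy
    by_contra h
    rw [Metric.mem_closedBall, not_le] at h
    exact hy (hzero y (by linarith))
  · intro y hy
    refine ψ.one_of_mem_closedBall ?_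
    rw [mem_closedBall_zero_iff, hnorm]
    exact (div_le_one hr).2 hy
  · intro y hy
    rw [Metric.mem_ball, not_lt] at hy
    exact hzero y (by linarith)
  · intro y
    rw [gradient, LinearIsometryEquiv.norm_map, (hder y).fderiv, norm_smul, norm_inv,
      Real.norm_of_nonneg hr.le]
    calc r⁻¹ * ‖fderiv ℝ ψ (r⁻¹ • (y - x))‖ ≤ r⁻¹ * C := by gcongr; exact hC _
      _ = C / r := by ring

/-- At a point of approximate continuity of `u`, the density of the gradient of `u` with respect to
a measure with at least linear growth vanishes. -/
lemma density_eq_zero_of_approxLimit {μ : Measure Plane} [IsFiniteMeasure μ] {θ : Plane → Plane}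
    (hθ : Integrable θ μ) {u : Plane → ℝ} (hu : Integrable u)
    (hgrad : ∀ φ : Plane → ℝ, ContDiff ℝ ∞ φ → HasCompactSupport φ →
      ∫ x, u x • gradient φ x = -∫ x, φ x • θ x ∂μ)
    {x : Plane}
    (hleb : Tendsto (fun r : ℝ ↦ ⨍ y in Metric.closedBall x r, ‖θ y - θ x‖ ∂μ) (𝓝[>] 0) (𝓝 0))
    {r₀ : ℝ} (hr₀ : 0 < r₀) (hlow : ∀ r ∈ Ioo 0 r₀, r ≤ μ.real (Metric.closedBall x r))
    {z : ℝ} (hz : Tendsto (fun r : ℝ ↦ ⨍ y in Metric.ball x r, |u y - z|) (𝓝[>] 0) (𝓝 0)) :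
    θ x = 0 := by
  obtain ⟨C, hC0, hC⟩ := exists_bump_gradient_le
  set m : ℝ → ℝ := fun r ↦ μ.real (Metric.closedBall x r) with hm
  set B : ℝ := (volume : Measure Plane).real (Metric.ball 0 1) with hB
  -- the basic inequality at scale `r`
  have key : ∀ r : ℝ, 0 < r → ‖θ x‖ * m r ≤
      C * (4 * B) * r * (⨍ y in Metric.ball x (2 * r), |u y - z|) +
        m (2 * r) * ⨍ y in Metric.closedBall x (2 * r), ‖θ y - θ x‖ ∂μ := by
    intro r hr
    obtain ⟨φ, hφ, hφc, hφ0, hφ1, hφone, hφzero, hg, hgz⟩ := hC x r hr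
    have hφ1' : ContDiff ℝ 1 φ := hφ.of_le (by exact_mod_cast le_top)
    have hcg : Continuous (gradient φ) :=
      (InnerProductSpace.toDual ℝ Plane).symm.continuous.comp
        (hφ1'.continuous_fderiv one_ne_zero)
    have hgi : Integrable (gradient φ) :=
      hcg.integrable_of_hasCompactSupport ((hφc.fderiv (𝕜 := ℝ)).comp_left (map_zero _))
    have hφb : ∀ y, ‖φ y‖ ≤ 1 := fun y ↦ by
      rw [Real.norm_of_nonneg (hφ0 y)]; exact hφ1 y
    have hφm : AEStronglyMeasurable φ μ := hφ.continuous.aestronglyMeasurable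
    have hφi : Integrable φ μ := Integrable.of_bound hφm 1 (Eventually.of_forall hφb)
    have hφθ : Integrable (fun y ↦ φ y • θ y) μ :=
      hθ.smul_of_top_right (memLp_top_of_bound hφm 1 (Eventually.of_forall hφb))
    have hui : Integrable fun y ↦ u y • gradient φ y :=
      hu.smul_of_top_left (memLp_top_of_bound hcg.aestronglyMeasurable _ (Eventually.of_forall hg))
    have hlow1 : m r ≤ ∫ y, φ y ∂μ := by
      rw [hm]
      simp only
      rw [← integral_indicator_one Metric.isClosed_closedBall.measurableSet]
      refine integral_mono ((integrable_const 1).indicator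
        Metric.isClosed_closedBall.measurableSet) hφi fun y ↦ ?_
      by_cases hy : y ∈ Metric.closedBall x r
      · rw [indicator_of_mem hy, hφone y hy]; rfl
      · rw [indicator_of_notMem hy]; exact hφ0 y
    have hdec : (∫ y, φ y ∂μ) • θ x = (∫ y, φ y • θ y ∂μ) - ∫ y, φ y • (θ y - θ x) ∂μ := by
      rw [← integral_smul_const, ← integral_sub hφθ]
      · congr 1
        ext1 y
        rw [smul_sub, sub_sub_cancel]
      · simp_rw [smul_sub]
        exact hφθ.sub (hφi.smul_const _)
    have hosc : ‖∫ y, φ y • (θ y - θ x) ∂μ‖ ≤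
        m (2 * r) * ⨍ y in Metric.closedBall x (2 * r), ‖θ y - θ x‖ ∂μ := by
      have hn : IntegrableOn (fun y ↦ ‖θ y - θ x‖) (Metric.closedBall x (2 * r)) μ :=
        ((hθ.sub (integrable_const _)).norm).integrableOn
      have h1 := measure_smul_setAverage (μ := μ) (fun y ↦ ‖θ y - θ x‖)
        (s := Metric.closedBall x (2 * r)) (measure_ne_top _ _)
      rw [smul_eq_mul] at h1
      rw [hm]
      simp only
      rw [h1, ← setIntegral_eq_integral_of_forall_compl_eq_zero (s := Metric.closedBall x (2 * r))]
      · refine norm_integral_le_of_norm_le hn (Eventually.of_forall fun y ↦ ?_)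
        rw [norm_smul]
        exact mul_le_of_le_one_left (norm_nonneg _) (hφb y)
      · intro y hy
        rw [hφzero y fun h ↦ hy (Metric.ball_subset_closedBall h), zero_smul]
    have hmain : ‖∫ y, φ y • θ y ∂μ‖ ≤
        C * (4 * B) * r * ⨍ y in Metric.ball x (2 * r), |u y - z| := by
      -- Area of order `r ^ 2` times a gradient of order `1 / r` leaves the factor `r` in front of
      -- the mean oscillation of `u`.
      have h0 : ∫ y, φ y • θ y ∂μ = -∫ y, (u y - z) • gradient φ y := by
        rw [integral_congr_ae (Eventually.of_forall fun y ↦ sub_smul (u y) z (gradient φ y)),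
          integral_sub hui (g := fun y ↦ z • gradient φ y) (hgi.smul z), integral_smul, integral_gradient_eq_zero hφ1' hφc,
          smul_zero, sub_zero, hgrad φ hφ hφc, neg_neg]
      have hvol : volume.real (Metric.ball x (2 * r)) = 4 * r ^ 2 * B := by
        rw [Measure.real, Measure.addHaar_ball _ _ (by positivity), ENNReal.toReal_mul,
          ENNReal.toReal_ofReal (by positivity), finrank_euclideanSpace_fin]
        rw [hB, Measure.real]
        ring
      have h1 := measure_smul_setAverage (μ := (volume : Measure Plane)) (fun y ↦ |u y - z|)
        (s := Metric.ball x (2 * r)) measure_ball_lt_top.ne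
      rw [smul_eq_mul, hvol] at h1
      have hn : IntegrableOn (fun y ↦ |u y - z|) (Metric.ball x (2 * r)) :=
        (hu.integrableOn.sub (integrableOn_const measure_ball_lt_top.ne)).norm
      rw [h0, norm_neg, ← setIntegral_eq_integral_of_forall_compl_eq_zero
        (s := Metric.ball x (2 * r)) (fun y hy ↦ by rw [hgz y hy, smul_zero])]
      calc ‖∫ y in Metric.ball x (2 * r), (u y - z) • gradient φ y‖
          ≤ ∫ y in Metric.ball x (2 * r), |u y - z| * (C / r) := by
            refine norm_integral_le_of_norm_le (hn.mul_const _) (Eventually.of_forall fun y ↦ ?_)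
            rw [norm_smul, Real.norm_eq_abs]
            gcongr
            exact hg y
        _ = _ := by
            rw [integral_mul_const, ← h1]
            field_simp
    calc ‖θ x‖ * m r ≤ ‖θ x‖ * ∫ y, φ y ∂μ := by gcongr
      _ = ‖(∫ y, φ y ∂μ) • θ x‖ := by
          rw [norm_smul, Real.norm_of_nonneg (integral_nonneg hφ0), mul_comm]
      _ ≤ _ := by
          rw [hdec]
          exact (norm_sub_le _ _).trans (add_le_add hmain hosc)
  -- pass to the limit along good scales
  have htwo : Tendsto (fun r : ℝ ↦ 2 * r) (𝓝[>] 0) (𝓝[>] 0) := by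
    refine tendsto_nhdsWithin_iff.2 ⟨?_, ?_⟩
    · have : Tendsto (fun r : ℝ ↦ 2 * r) (𝓝 0) (𝓝 (2 * 0)) := tendsto_id.const_mul 2
      rw [mul_zero] at this
      exact this.mono_left nhdsWithin_le_nhds
    · filter_upwards [self_mem_nhdsWithin] with r hr
      exact mul_pos two_pos (mem_Ioi.1 hr)
  have hlim : Tendsto (fun r : ℝ ↦ C * (4 * B) * (⨍ y in Metric.ball x (2 * r), |u y - z|) +
      4 * ⨍ y in Metric.closedBall x (2 * r), ‖θ y - θ x‖ ∂μ) (𝓝[>] 0) (𝓝 0) := by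
    simpa using ((hz.comp htwo).const_mul (C * (4 * B))).add ((hleb.comp htwo).const_mul 4)
  by_contra hne
  have hpos : 0 < ‖θ x‖ := norm_pos_iff.2 hne
  have hev := hlim.eventually_lt_const hpos
  have hfreq := (frequently_measureReal_closedBall_two_mul_le hr₀ hlow).and_eventually
    (hev.and (Ioo_mem_nhdsGT hr₀))
  obtain ⟨r, hr4, hrlt, hr⟩ := hfreq.exists
  have hmr : r ≤ m r := hlow r hr
  have hmpos : 0 < m r := hr.1.trans_le hmr
  have hB0 : 0 ≤ B := measureReal_nonneg
  have hA1 : 0 ≤ ⨍ y in Metric.ball x (2 * r), |u y - z| := by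
    rw [setAverage_eq]
    exact smul_nonneg (by positivity) (integral_nonneg fun y ↦ abs_nonneg _)
  have hA2 : 0 ≤ ⨍ y in Metric.closedBall x (2 * r), ‖θ y - θ x‖ ∂μ := by
    rw [setAverage_eq]
    exact smul_nonneg (by positivity) (integral_nonneg fun y ↦ norm_nonneg _)
  -- At the chosen scale `r ≤ m r` and `m (2 * r) ≤ 4 * m r`, so `m r` factors out of both terms and
  -- can be cancelled.
  have h1 : ‖θ x‖ * m r ≤ (C * (4 * B) * (⨍ y in Metric.ball x (2 * r), |u y - z|) +
      4 * ⨍ y in Metric.closedBall x (2 * r), ‖θ y - θ x‖ ∂μ) * m r := by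
    refine (key r hr.1).trans ?_
    calc _ ≤ C * (4 * B) * m r * (⨍ y in Metric.ball x (2 * r), |u y - z|) +
          4 * m r * ⨍ y in Metric.closedBall x (2 * r), ‖θ y - θ x‖ ∂μ := by gcongr
      _ = _ := by ring
  exact absurd (lt_of_mul_lt_mul_right (h1.trans_lt (mul_lt_mul_of_pos_right hrlt hmpos))
    hmpos.le) (lt_irrefl _)

/-- A simple rectifiable curve has at least linear `ℋ¹`-growth at each of its points. -/
lemma IsSimpleRectifiableCurve.exists_linear_growth {c : ℝ → Plane} {P R : Plane}
    (hc : IsSimpleRectifiableCurve c P R) {K : Set Plane} (hK : curveSupport c ⊆ K)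
    (hfin : μH[1] K ≠ ⊤) {x : Plane} (hx : x ∈ curveSupport c) :
    ∃ r₀ > 0, ∀ r ∈ Ioo 0 r₀,
      r ≤ ((μH[1] : Measure Plane).restrict K).real (Metric.closedBall x r) := by
  -- Even when `P = R` the curve is not a point: simplicity separates `c 0` from `c (1 / 2)`.
  obtain ⟨y, hy, hxy⟩ : ∃ y ∈ curveSupport c, y ≠ x := by
    have h0 : (0 : ℝ) ∈ Icc (0 : ℝ) 1 := ⟨le_rfl, zero_le_one⟩
    have h2 : (1 / 2 : ℝ) ∈ Ioo (0 : ℝ) 1 := by constructor <;> norm_num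
    by_cases h : c 0 = x
    · refine ⟨c (1 / 2), mem_image_of_mem c (Ioo_subset_Icc_self h2), fun h' ↦ ?_⟩
      have := hc.eq_of_mem_Ioo h0 h2 (h.trans h'.symm)
      norm_num at this
    · exact ⟨c 0, mem_image_of_mem c h0, h⟩
  refine ⟨dist x y, dist_pos.2 hxy.symm, fun r hr ↦ ?_⟩
  have h1 := hc.isPreconnected_curveSupport.ofReal_le_hausdorffMeasure_inter_ball hx hy hr.2.le
  have : IsFiniteMeasure ((μH[1] : Measure Plane).restrict K) := isFiniteMeasure_restrict.2 hfin
  refine (ENNReal.ofReal_le_iff_le_toReal (measure_ne_top _ _)).1 (h1.trans ?_)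
  rw [Measure.restrict_apply Metric.isClosed_closedBall.measurableSet, inter_comm]
  exact measure_mono (inter_subset_inter Metric.ball_subset_closedBall hK)

lemma IsOrientedBy.integrableOn {c : ℝ → Plane} {τ : Plane → Plane} (hτ : IsOrientedBy c τ)
    (hfin : μH[1] (curveSupport c) ≠ ⊤) : IntegrableOn τ (curveSupport c) μH[1] := by
  have : IsFiniteMeasure ((μH[1] : Measure Plane).restrict (curveSupport c)) :=
    isFiniteMeasure_restrict.2 hfin
  exact Integrable.of_bound hτ.measurable 1 (hτ.norm_eq_one.mono fun x hx ↦ hx.le)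

/-! ### Rotated densities, the SBV criterion and the conclusion. -/

lemma rotPerp_rotPerp (v : Plane) : rotPerp (rotPerp v) = -v := by
  ext i
  fin_cases i <;> simp [rotPerp]

lemma integral_rotPerp {X : Type*} [MeasurableSpace X] {μ : Measure X} {f : X → Plane}
    (hf : Integrable f μ) : ∫ x, rotPerp (f x) ∂μ = rotPerp (∫ x, f x ∂μ) :=
  (LinearMap.toContinuousLinearMap rotPerp).integral_comp_comm hf

lemma perpMeasure_withDensityᵥ_neg_rotPerp {μ : Measure Plane} {θ : Plane → Plane}
    (hθ : Integrable θ μ) :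
    perpMeasure (μ.withDensityᵥ fun x ↦ -rotPerp (θ x)) = μ.withDensityᵥ θ := by
  have hJ : Integrable (fun x ↦ rotPerp (θ x)) μ :=
    (LinearMap.toContinuousLinearMap rotPerp).integrable_comp hθ
  ext1 s hs
  change rotPerp ((μ.withDensityᵥ fun x ↦ -rotPerp (θ x)) s) = _
  rw [withDensityᵥ_apply (f := fun x ↦ -rotPerp (θ x)) hJ.neg hs, withDensityᵥ_apply hθ hs,
    integral_neg, integral_rotPerp hθ.integrableOn, map_neg, rotPerp_rotPerp, neg_neg]

/-- An integrable function whose gradient has a density with respect to a measure of at least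
linear growth is a special function of bounded variation. -/
lemma isSBV_of_linear_growth {μ : Measure Plane} [IsFiniteMeasure μ] {θ : Plane → Plane}
    (hθ : Integrable θ μ) {u : Plane → ℝ} (hu : Integrable u)
    (hgrad : ∀ φ : Plane → ℝ, ContDiff ℝ ∞ φ → HasCompactSupport φ →
      ∫ x, u x • gradient φ x = -∫ x, φ x • θ x ∂μ)
    (hgrowth : ∀ᵐ x ∂μ, ∃ r₀ > 0, ∀ r ∈ Ioo 0 r₀, r ≤ μ.real (Metric.closedBall x r)) :
    IsSBV u (μ.withDensityᵥ θ) where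
  integrable := hu
  hasGradientMeasure := by
    intro φ hφ hc
    obtain ⟨C, hC⟩ := hc.exists_bound_of_continuous hφ.continuous
    rw [integral_withDensityᵥ hθ hφ.continuous.stronglyMeasurable hC]
    exact hgrad φ hφ hc
  cantorPart_eq_zero := by
    -- The whole variation, not only its singular part, is null off `S_u`: there `θ` vanishes at
    -- `μ`-almost every point.
    refine le_antisymm ((Measure.singularPart_le _ _ _).trans ?_) zero_le
    rw [Measure.variation_withDensityᵥ hθ,
      (withDensity_apply_eq_zero' hθ.aestronglyMeasurable.enorm).2]
    have hleb := (Besicovitch.vitaliFamily μ).ae_tendsto_average_norm_sub hθ.locallyIntegrable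
    rw [← compl_compl ({x | ‖θ x‖ₑ ≠ 0} ∩ _)]
    refine mem_ae_iff.1 ?_
    filter_upwards [hleb, hgrowth] with x hx hgx
    rintro ⟨hne, hS⟩
    obtain ⟨r₀, hr₀, hlow⟩ := hgx
    obtain ⟨z, hz⟩ := not_not.1 hS
    refine hne ?_
    rw [density_eq_zero_of_approxLimit hθ hu hgrad
      (hx.comp (Besicovitch.tendsto_filterAt μ x)) hr₀ hlow hz, enorm_zero]

theorem mainTheorem8 (P R : Plane) (l g : ℝ → Plane) (τ' τ'' : Plane → Plane)
    (hl : IsSimpleRectifiableCurve l P R) (hg : IsSimpleRectifiableCurve g P R)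
    (hτ' : IsOrientedBy l τ') (hτ'' : IsOrientedBy g τ'') :
    ∃ (u : Plane → ℝ) (Du : VectorMeasure Plane Plane),
      IsSBVInt u Du ∧ perpMeasure Du = curveMeasure g τ'' - curveMeasure l τ' := by
  obtain ⟨hlfin, Ll, wl, hLl, hwl, hwl0, hwl1, hintl⟩ := hl.exists_lipschitz_parametrization hτ'
  obtain ⟨hgfin, Lg, wg, hLg, hwg, hwg0, hwg1, hintg⟩ := hg.exists_lipschitz_parametrization hτ''
  obtain ⟨vl, hvl, hvlint, hvlgrad⟩ := hwl.exists_integer_filling hLl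
  obtain ⟨vg, hvg, hvgint, hvggrad⟩ := hwg.exists_integer_filling hLg
  set K : Set Plane := curveSupport g ∪ curveSupport l with hK
  have hml : MeasurableSet (curveSupport l) := hl.isCompact_curveSupport.measurableSet
  have hmg : MeasurableSet (curveSupport g) := hg.isCompact_curveSupport.measurableSet
  have hKfin : μH[1] K ≠ ⊤ :=
    ((measure_union_le _ _).trans_lt (ENNReal.add_lt_top.2 ⟨hgfin.lt_top, hlfin.lt_top⟩)).ne
  set μ : Measure Plane := (μH[1]).restrict K with hμ
  have : IsFiniteMeasure μ := isFiniteMeasure_restrict.2 hKfin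
  have hrl : μ.restrict (curveSupport l) = (μH[1]).restrict (curveSupport l) := by
    rw [hμ, Measure.restrict_restrict hml, inter_eq_self_of_subset_left subset_union_right]
  have hrg : μ.restrict (curveSupport g) = (μH[1]).restrict (curveSupport g) := by
    rw [hμ, Measure.restrict_restrict hmg, inter_eq_self_of_subset_left subset_union_left]
  set θl : Plane → Plane := (curveSupport l).indicator τ' with hθl
  set θg : Plane → Plane := (curveSupport g).indicator τ'' with hθg
  have hil : Integrable θl μ := by
    rw [hθl, integrable_indicator_iff hml, IntegrableOn, hrl]
    exact hτ'.integrableOn hlfin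
  have hig : Integrable θg μ := by
    rw [hθg, integrable_indicator_iff hmg, IntegrableOn, hrg]
    exact hτ''.integrableOn hgfin
  have hθ : Integrable (θg - θl) μ := hig.sub hil
  have hD : Integrable (fun x ↦ -rotPerp ((θg - θl) x)) μ :=
    ((LinearMap.toContinuousLinearMap rotPerp).integrable_comp hθ).neg
  -- The filling of `l` comes first because of the minus sign in the definition of the
  -- distributional gradient; `-rotPerp` is the inverse of `rotPerp`.
  refine ⟨fun x ↦ vl x - vg x, μ.withDensityᵥ fun x ↦ -rotPerp ((θg - θl) x),
    ⟨isSBV_of_linear_growth hD (hvl.sub hvg) ?_ ?_, ?_⟩, ?_⟩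
  · intro φ hφ hc
    have hφ1 : ContDiff ℝ 1 φ := hφ.of_le (by exact_mod_cast le_top)
    have hcg : Continuous (gradient φ) :=
      (InnerProductSpace.toDual ℝ Plane).symm.continuous.comp (hφ1.continuous_fderiv one_ne_zero)
    have hcs : HasCompactSupport (gradient φ) := (hc.fderiv (𝕜 := ℝ)).comp_left (map_zero _)
    obtain ⟨C, hC⟩ := hcs.exists_bound_of_continuous hcg
    obtain ⟨C', hC'⟩ := hc.exists_bound_of_continuous hφ.continuous
    have htop := memLp_top_of_bound (μ := (volume : Measure Plane)) hcg.aestronglyMeasurable C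
      (Eventually.of_forall hC)
    have htop' := memLp_top_of_bound (μ := μ) hφ.continuous.aestronglyMeasurable C'
      (Eventually.of_forall hC')
    have hIl : Integrable (fun x ↦ vl x • gradient φ x) := hvl.smul_of_top_left htop
    have hIg : Integrable (fun x ↦ vg x • gradient φ x) := hvg.smul_of_top_left htop
    have hφl : Integrable (fun x ↦ φ x • θl x) μ := hil.smul_of_top_right htop'
    have hφg : Integrable (fun x ↦ φ x • θg x) μ := hig.smul_of_top_right htop'
    have hφθ : Integrable (fun x ↦ φ x • (θg - θl) x) μ := hθ.smul_of_top_right htop'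
    have hl' : ∫ x, φ x • θl x ∂μ = ∫ x in curveSupport l, φ x • τ' x ∂μH[1] := by
      rw [← hrl, ← integral_indicator hml]
      exact integral_congr_ae (Eventually.of_forall fun x ↦ by
        by_cases hx : x ∈ curveSupport l <;> simp [hθl, hx])
    have hg' : ∫ x, φ x • θg x ∂μ = ∫ x in curveSupport g, φ x • τ'' x ∂μH[1] := by
      rw [← hrg, ← integral_indicator hmg]
      exact integral_congr_ae (Eventually.of_forall fun x ↦ by
        by_cases hx : x ∈ curveSupport g <;> simp [hθg, hx])
    -- The two chord terms are both the segment from `P` to `R` and cancel.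
    have hJ : rotPerp (∫ x, (vl x - vg x) • gradient φ x) = -∫ x, φ x • (θg - θl) x ∂μ := by
      simp_rw [sub_smul, Pi.sub_apply, smul_sub]
      rw [integral_sub hIl hIg,
        integral_sub hφg hφl, map_sub, hvlgrad φ hφ1 hc, hvggrad φ hφ1 hc, hwl0, hwl1, hwg0, hwg1,
        hl', hg', hintl φ hφ.continuous, hintg φ hφ.continuous]
      abel
    have h1 : ∫ x, φ x • -rotPerp ((θg - θl) x) ∂μ =
        -rotPerp (∫ x, φ x • (θg - θl) x ∂μ) := by
      rw [← integral_rotPerp hφθ, ← integral_neg]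
      simp only [map_smul, smul_neg]
    rw [h1, neg_neg, ← neg_neg (∫ x, φ x • (θg - θl) x ∂μ), ← hJ, map_neg, rotPerp_rotPerp,
      neg_neg]
  · refine (ae_restrict_iff' (hmg.union hml)).2 (Eventually.of_forall fun x hx ↦ ?_)
    rcases hx with hx | hx
    · exact hg.exists_linear_growth subset_union_left hKfin hx
    · exact hl.exists_linear_growth subset_union_right hKfin hx
  · filter_upwards [hvlint, hvgint] with x ⟨m, hm⟩ ⟨n, hn⟩
    exact ⟨m - n, by simp [hm, hn]⟩
  · rw [perpMeasure_withDensityᵥ_neg_rotPerp hθ, withDensityᵥ_sub hig hil, curveMeasure,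
      curveMeasure, restrict_withDensityᵥ_eq_indicator hmg subset_union_left
        (hτ''.integrableOn hgfin), restrict_withDensityᵥ_eq_indicator hml subset_union_right
        (hτ'.integrableOn hlfin)]
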